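/- **Setting.** Let $G$ be an acyclic directed mixed graph (ADMG) on a finite vertex set $\vec V$: it has directed edges without directed cycles, and bidirected edges between distinct vertices. Let $d$ be the maximum in-degree of $G$ (number of directed edges into a vertex). The c-components of $G$ are the maximal sets of vertices connected by bidirected edges; let $k$ be the size of the largest one. Let $\Sigma$ be a finite alphabet. A (semi-Markovian) causal Bayes net $\mathcal P$ over $G$ has observable variables $\vec V$ with values in $\Sigma$, and finitely many independent hidden variables with values in arbitrary probability spaces. Hidden variables have no parents and each affects exactly two observable variables; the bidirected edges of $G$ are exactly the pairs of observable variables that have a common hidden parent. Each observable variable has a conditional distribution given its observable parents (the directed edges of $G$) and its hidden parents. $P$ denotes the joint law of $\vec V$, and for $X\in\vec V$, $x\in\Sigma$, $P_x$ denotes the law of $\vec V$ after replacing the conditional distribution of $X$ by the point mass at $x$. For $\vec F\subseteq \vec V$, $P_x|_{\vec F}$ is the marginal of $P_x$ on $\vec F$. Let $\vec S_1$ be the c-component of $X$ and $\vec Z=\vec S_1\cup\bigcup_{V\in \vec S_1}\mathrm{Pa}(V)$, where $\mathrm{Pa}(V)$ are the observable parents of $V$. $G$ is identifiable with respect to $X$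 if no child of $X$ lies in $\vec S_1$. $\mathcal P$ is $\alpha$-strongly positive with respect to $X$ if $P(\vec Z=\vec z)>\alpha$ for every assignment $\vec z\in\Sigma^{\vec Z}$. Algorithms are programs for a unit-cost random access machine (arithmetic operations on rational numbers, comparison jumps, indirect addressing, and reading the symbol of a given variable in a given sample, each at cost one). An evaluator for a distribution $p$ on $\Sigma^{\vec F}$ consists of the memory left by the algorithm and a program, fixed before the samples are drawn, that, started on this memory with an assignment $\vec w\in\Sigma^{\vec F}$ as input, outputs $p(\vec w)$. **Theorem.** There are universal constants $C>0$ and $c\in\mathbb N$ such that the following holds. Let $G$ be a (known) ADMG on $\vec V$ that is identifiable with respect to $X\in\vec V$, let $\vec F\subseteq\vec V$ with $|\vec F|=f$, let $x\in\Sigma$ be an intervention to $X$, let $\alpha,\epsilon,\delta\in(0,1)$, and put $$N=f+k(d+1),\qquad B=\frac{|\Sigma|^{2N^2}}{\alpha^k\epsilon^2}.$$ Then there are a number $$m\le C\,B\,(1+\log B)^{c}\,(1+\log(1/\delta)),\qquad\text{i.e. } m=\tilde O\!\left(\frac{|\Sigma|^{2(f+k(d+1))^2}}{\alpha^k\epsilon^2}\right)\cdot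 O(1+\log(1/\delta)),$$ and an algorithm that takes $m$ samples and, on every sample sequence, halts within $$T=C\,m\,(f+k(d+1))\,|\Sigma|^{2(f+k(d+1))^2}$$ steps, such that for every causal Bayes net $\mathcal P$ over $G$ that is $\alpha$-strongly positive with respect to $X$, the following holds with probability at least $1-\delta$ over $m$ independent samples from the observational distribution $P$: the algorithm returns an evaluator for a probability distribution $\tilde P_{\vec F}$ on $\Sigma^{\vec F}$ with $$d_{\mathrm{TV}}(P_x|_{\vec F},\tilde P_{\vec F})\le\epsilon .$$ Moreover, the lengths of the algorithm's program and of the evaluation program, and the time of every evaluation, are also at most $T$. None of the bounds depends on $n=|\vec V|$. -/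

import Mathlib

universe u v w

/-! ### Acyclic directed mixed graphs -/

/-- An acyclic directed mixed graph (ADMG) on the vertex set `V`: directed edges without
directed cycles, and (undirected, loopless) bidirected edges. A pair of vertices may carry both. -/
structure ADMG (V : Type*) where
  /-- `directed a b` means that there is a directed edge `a → b`. -/
  directed : V → V → Prop
  acyclic : ∀ v, ¬ Relation.TransGen directed v v
  bidirected : SimpleGraph V

namespace ADMG

variable {V : Type*} [Fintype V] (G : ADMG V)

open Classical in
/-- The (observable) parents of a vertex. -/
noncomputable def parents (v : V) : Finset V :=
  Finset.univ.filter fun p => G.directed p v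

/-- The maximum number of directed edges coming into any vertex. -/
noncomputable def inDegree : ℕ :=
  Finset.univ.sup fun v => (G.parents v).card

open Classical in
/-- The c-component of a vertex: all vertices joined to it by a path of bidirected edges. -/
noncomputable def cComponent (v : V) : Finset V :=
  Finset.univ.filter fun w => G.bidirected.Reachable v w

/-- The size of the largest c-component. -/
noncomputable def maxCComponent : ℕ :=
  Finset.univ.sup fun v => (G.cComponent v).card

/-- `S` together with all parents of its elements. -/
noncomputable def paPlus [DecidableEq V] (S : Finset V) : Finset V :=
  S ∪ S.biUnion G.parents

/-- Identifiability with respect to `X`: no child of `X` lies in the c-component of `X`. -/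
def Identifiable (X : V) : Prop :=
  ∀ c, G.directed X c → c ∉ G.cComponent X

end ADMG

/-! ### Finite distributions, given by their mass functions -/

/-- `p` is a probability mass function on the finite type `Ω`. -/
def IsDistribution {Ω : Type*} [Fintype Ω] (p : Ω → ℝ) : Prop :=
  (∀ w, 0 ≤ p w) ∧ ∑ w, p w = 1

/-- Total variation distance of two mass functions on a finite type. -/
noncomputable def tvDist {Ω : Type*} [Fintype Ω] (p q : Ω → ℝ) : ℝ :=
  (1 / 2) * ∑ w, |p w - q w|

/-- The marginal on the coordinates in `S` of a mass function on `V → A`. -/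
def marginal {V A : Type*} [Fintype V] [DecidableEq V] [Fintype A] [DecidableEq A]
    (S : Finset V) (p : (V → A) → ℝ) (w : S → A) : ℝ :=
  ∑ σ : V → A with (fun v : S => σ v) = w, p σ

open Classical in
/-- The probability of the event `Good` for `m` independent samples drawn from `p`. -/
noncomputable def iidProb {Ω : Type*} [Fintype Ω] (p : Ω → ℝ) (m : ℕ)
    (Good : (Fin m → Ω) → Prop) : ℝ :=
  ∑ s : Fin m → Ω with Good s, ∏ i, p (s i)

/-! ### Causal Bayes nets -/

/-- A (semi-Markovian) causal Bayes net over the ADMG `G` whose observable variables are the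
vertices of `G`, with values in `A`. Every hidden variable is a root of the underlying graph, takes
values in an arbitrary probability space, and affects exactly two observable variables; the
bidirected edges of `G` are the pairs of observable variables with a common hidden parent. The
hidden variables are independent, and every observable variable has a conditional distribution
given its observable and hidden parents. -/
structure CausalBayesNet {V : Type u} (G : ADMG V) (A : Type v) [Fintype A] where
  /-- The index set of the hidden variables. -/
  Hidden : Type w
  [fintypeHidden : Fintype Hidden]
  /-- The two observable variables that a hidden variable affects. -/
  ends : Hidden → Sym2 V
  range_ends : Set.range ends = G.bidirected.edgeSet
  /-- The range of each hidden variable. -/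
  Val : Hidden → Type w
  [measurableSpaceVal : ∀ h, MeasurableSpace (Val h)]
  /-- The law of each hidden variable. -/
  prior : ∀ h, MeasureTheory.Measure (Val h)
  [isProbabilityMeasure_prior : ∀ h, MeasureTheory.IsProbabilityMeasure (prior h)]
  /-- `mech v pa u a` is the conditional probability that the variable `v` equals `a` given the
  values `pa` of its observable parents and the values `u` of its hidden parents. -/
  mech : ∀ v : V, ({p // G.directed p v} → A) → (∀ h : {h // v ∈ ends h}, Val h) → A → ℝ
  measurable_mech : ∀ v pa a, Measurable fun u => mech v pa u a
  mech_nonneg : ∀ v pa u a, 0 ≤ mech v pa u a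
  mech_sum : ∀ v pa u, ∑ a, mech v pa u a = 1

namespace CausalBayesNet

attribute [instance] CausalBayesNet.fintypeHidden CausalBayesNet.measurableSpaceVal
  CausalBayesNet.isProbabilityMeasure_prior

variable {V : Type u} [Fintype V] [DecidableEq V] {G : ADMG V} {A : Type v} [Fintype A]
  [DecidableEq A] (M : CausalBayesNet.{u, v, w} G A)

/-- The joint law of the (independent) hidden variables. -/
noncomputable def hiddenLaw : MeasureTheory.Measure (∀ h, M.Val h) :=
  MeasureTheory.Measure.pi M.prior

/-- The conditional probability of the value `σ v` of the variable `v` under the full assignment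
`σ` to the observable and `u` to the hidden variables. -/
def factor (σ : V → A) (u : ∀ h, M.Val h) (v : V) : ℝ :=
  M.mech v (fun p => σ p.1) (fun h => u h.1) (σ v)

/-- The observational distribution `P`, as a mass function. -/
noncomputable def obs (σ : V → A) : ℝ :=
  ∫ u, ∏ v, M.factor σ u v ∂M.hiddenLaw

/-- The interventional distribution `P_x` for the intervention that sets `X` to `x`, as a mass
function on the assignments to all observable variables: the conditional distribution of `X` is
replaced by the point mass at `x`. -/
noncomputable def interv (X : V) (x : A) (σ : V → A) : ℝ :=
  if σ X = x then ∫ u, ∏ v ∈ Finset.univ.erase X, M.factor σ u v ∂M.hiddenLaw else 0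

/-- `α`-strong positivity with respect to `X`: with `S` the c-component of `X`, every assignment
to `S` and its parents has observational probability larger than `α`. -/
def StronglyPositive (X : V) (α : ℝ) : Prop :=
  ∀ z : G.paPlus (G.cComponent X) → A, α < marginal (G.paPlus (G.cComponent X)) M.obs z

end CausalBayesNet

/-! ### Random access machines with step count -/

/-- The instructions of a unit-cost random access machine. Its memory cells are indexed by `ℕ` and
hold rational numbers; an indirect address is the content of a cell, rounded down. The input device
holds for every index `i` and every variable `v : V` one symbol, given by its number. -/
inductive Instr (V : Type*) where
  /-- `mem[dst] := c` -/
  | const (dst c : ℕ)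
  /-- `mem[dst] := mem[a] + mem[b]` -/
  | add (dst a b : ℕ)
  /-- `mem[dst] := mem[a] - mem[b]` -/
  | sub (dst a b : ℕ)
  /-- `mem[dst] := mem[a] * mem[b]` -/
  | mul (dst a b : ℕ)
  /-- `mem[dst] := mem[a] / mem[b]`, where division by zero gives zero -/
  | div (dst a b : ℕ)
  /-- `mem[dst] := mem[mem[a]]` -/
  | load (dst a : ℕ)
  /-- `mem[mem[a]] := mem[b]` -/
  | store (a b : ℕ)
  /-- go to instruction number `target` if `mem[a] ≤ mem[b]` -/
  | jumpLE (a b target : ℕ)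
  /-- `mem[dst] :=` the input symbol with index `mem[i]` for the variable `v` -/
  | read (dst i : ℕ) (v : V)

/-- A configuration: the number of the next instruction, and the memory. -/
structure Config where
  pc : ℕ
  mem : ℕ → ℚ

namespace RAM

variable {V : Type*}

/-- Execution of one instruction with the input `inp`. -/
def exec (inp : ℕ → V → ℕ) (s : Config) : Instr V → Config
  | .const dst c => ⟨s.pc + 1, Function.update s.mem dst (c : ℚ)⟩
  | .add dst a b => ⟨s.pc + 1, Function.update s.mem dst (s.mem a + s.mem b)⟩
  | .sub dst a b => ⟨s.pc + 1, Function.update s.mem dst (s.mem a - s.mem b)⟩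
  | .mul dst a b => ⟨s.pc + 1, Function.update s.mem dst (s.mem a * s.mem b)⟩
  | .div dst a b => ⟨s.pc + 1, Function.update s.mem dst (s.mem a / s.mem b)⟩
  | .load dst a => ⟨s.pc + 1, Function.update s.mem dst (s.mem ⌊s.mem a⌋₊)⟩
  | .store a b => ⟨s.pc + 1, Function.update s.mem ⌊s.mem a⌋₊ (s.mem b)⟩
  | .jumpLE a b target => ⟨if s.mem a ≤ s.mem b then target else s.pc + 1, s.mem⟩
  | .read dst i v => ⟨s.pc + 1, Function.update s.mem dst (inp ⌊s.mem i⌋₊ v : ℚ)⟩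

/-- One step of the program `prog`; it has halted when there is no next instruction. -/
def step (prog : List (Instr V)) (inp : ℕ → V → ℕ) (s : Config) : Config :=
  match prog[s.pc]? with
  | none => s
  | some instr => exec inp s instr

/-- Started on the memory `mem`, the program `prog` halts after at most `T` steps and leaves the
memory `mem'`. -/
def HaltsWithin (prog : List (Instr V)) (inp : ℕ → V → ℕ) (mem : ℕ → ℚ) (T : ℝ)
    (mem' : ℕ → ℚ) : Prop :=
  ∃ t pc' : ℕ, (t : ℝ) ≤ T ∧ (step prog inp)^[t] ⟨0, mem⟩ = ⟨pc', mem'⟩ ∧ prog.length ≤ pc'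

variable {A : Type*} [Fintype A]

/-- The number of a symbol of the alphabet, in `0, …, |A| - 1`. -/
noncomputable def code (a : A) : ℕ := (Fintype.equivFin A a : ℕ)

/-- The input that consists of `m` samples. -/
noncomputable def sampleInput {m : ℕ} (s : Fin m → V → A) (i : ℕ) (v : V) : ℕ :=
  if h : i < m then code (s ⟨i, h⟩ v) else 0

/-- The input that consists of one assignment to the variables in `F`. -/
noncomputable def queryInput [DecidableEq V] {F : Finset V} (w : F → A) (_ : ℕ) (v : V) : ℕ :=
  if h : v ∈ F then code (w ⟨v, h⟩) else 0

/-- Started on the memory `mem`, which is all the data it gets, the program `eval` is an evaluator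
for `p`: for every assignment `w` to `F` it halts after at most `T` steps with the value `p w` in
cell `0`. -/
def IsEvaluator [DecidableEq V] (eval : List (Instr V)) (mem : ℕ → ℚ) (T : ℝ) {F : Finset V}
    (p : (F → A) → ℝ) : Prop :=
  ∀ w : F → A, ∃ mem' : ℕ → ℚ,
    HaltsWithin eval (queryInput w) mem T mem' ∧ ((mem' 0 : ℚ) : ℝ) = p w

end RAM

/-!
Write `Q[T]` for the law of the variables in `T` under an intervention on all others; `P` is the
product of the `Q[C]` over the c-components `C`. Let `S` be the c-component of `X` and `Z` the set
`S` together with its parents. The marginal of `P` on the part of `Z` that precedes a vertex `v` in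
a topological order is `Q` of the preceding part of `S` times a factor which does not change when a
vertex of `S` is added; hence `Q[S]` is the product over `v ∈ S` of the conditional probabilities of
`v` given the earlier variables of `Z`. As no child of `X` lies in `S`, summing `Q[S]` over the
value of `X` gives `Q[S \ {X}]`, so on the event that `X` has the value `x`
`P_x = P * (∑ a, Q[S](X = a)) / Q[S]`, an explicit functional of the marginal of `P` on `F ∪ Z`.

The learner plugs empirical frequencies into this functional. All marginals of `P` on subsets of `Z`
exceed `α`, so by Chernoff bounds their empirical versions have small relative errors, which survive
products and quotients. A joint probability on `F ∪ Z` may be tiny, but it enters linearly and needs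
only an error that is small relative to the probability of its `Z`-part. Normalising the result at
most doubles the `ℓ¹` error, which the factor `1 / 2` in the total variation distance absorbs.

Both programs are straight-line: the first tabulates the functional on all assignments to `F`, and
the second looks up the queried entry and divides by the sum of the table.
-/

/-! ### Straight-line programs -/

namespace RAM

variable {V : Type*}

/-- A program is jump-free if it contains no jump instruction; it then takes exactly as many steps
as it has instructions. -/
def JumpFree (prog : List (Instr V)) : Prop :=
  ∀ a b target, .jumpLE a b target ∉ prog

/-- The memory that a jump-free program leaves when it is started on `mem`. -/
def run (inp : ℕ → V → ℕ) (prog : List (Instr V)) (mem : ℕ → ℚ) : ℕ → ℚ :=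
  prog.foldl (fun mem i => (exec inp ⟨0, mem⟩ i).mem) mem

theorem JumpFree.append {prog₁ prog₂ : List (Instr V)} (h₁ : JumpFree prog₁)
    (h₂ : JumpFree prog₂) : JumpFree (prog₁ ++ prog₂) := fun a b target h =>
  (List.mem_append.1 h).elim (h₁ a b target) (h₂ a b target)

theorem run_append (inp : ℕ → V → ℕ) (prog₁ prog₂ : List (Instr V)) (mem : ℕ → ℚ) :
    run inp (prog₁ ++ prog₂) mem = run inp prog₂ (run inp prog₁ mem) :=
  List.foldl_append

theorem exec_eq_of_ne_jumpLE (inp : ℕ → V → ℕ) (s : Config) {i : Instr V}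
    (hi : ∀ a b target, i ≠ .jumpLE a b target) :
    exec inp s i = ⟨s.pc + 1, run inp [i] s.mem⟩ := by
  cases i <;> first | rfl | exact absurd rfl (hi _ _ _)

theorem JumpFree.iterate_step {prog : List (Instr V)} (h : JumpFree prog) (inp : ℕ → V → ℕ)
    (mem : ℕ → ℚ) {n : ℕ} (hn : n ≤ prog.length) :
    (step prog inp)^[n] ⟨0, mem⟩ = ⟨n, run inp (prog.take n) mem⟩ := by
  induction n with
  | zero => rfl
  | succ n ih =>
    have hlt : n < prog.length := hn
    have hne : ∀ a b target, prog[n] ≠ .jumpLE a b target := fun a b target he =>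
      h a b target (he ▸ List.getElem_mem hlt)
    rw [Function.iterate_succ_apply', ih hlt.le, step]
    simp only [List.getElem?_eq_getElem hlt]
    rw [exec_eq_of_ne_jumpLE inp _ hne, List.take_succ_eq_append_getElem hlt, run_append]

theorem JumpFree.haltsWithin {prog : List (Instr V)} (h : JumpFree prog) (inp : ℕ → V → ℕ)
    (mem : ℕ → ℚ) {T : ℝ} (hT : (prog.length : ℝ) ≤ T) :
    HaltsWithin prog inp mem T (run inp prog mem) :=
  ⟨prog.length, prog.length, hT, by rw [h.iterate_step inp mem le_rfl, List.take_length], le_rfl⟩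

/-- The binary operations of the machine. -/
inductive ArithOp where
  | add
  | sub
  | mul
  | div

namespace ArithOp

/-- The operation on rational numbers; as for the machine, `a / 0 = 0`. -/
def eval : ArithOp → ℚ → ℚ → ℚ
  | add => (· + ·)
  | sub => (· - ·)
  | mul => (· * ·)
  | div => (· / ·)

/-- The instruction `mem[dst] := mem[a] op mem[b]`. -/
def instr : ArithOp → ℕ → ℕ → ℕ → Instr V
  | add => .add
  | sub => .sub
  | mul => .mul
  | div => .div

theorem jumpFree_instr (o : ArithOp) (dst a b : ℕ) : JumpFree [(o.instr dst a b : Instr V)] := by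
  cases o <;> simp [JumpFree, instr]

theorem run_instr (o : ArithOp) (inp : ℕ → V → ℕ) (dst a b : ℕ) (mem : ℕ → ℚ) :
    run inp [o.instr dst a b] mem = Function.update mem dst (o.eval (mem a) (mem b)) := by
  cases o <;> rfl

end ArithOp

/-- Arithmetic expressions in constants, input symbols and the contents of memory cells: the source
language of the straight-line programs below. -/
inductive ArithExpr (V : Type*) where
  | const (c : ℕ)
  | read (i : ℕ) (v : V)
  | cell (a : ℕ)
  | op (o : ArithOp) (e₁ e₂ : ArithExpr V)

namespace ArithExpr

/-- The value of an expression. -/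
def eval (inp : ℕ → V → ℕ) (mem : ℕ → ℚ) : ArithExpr V → ℚ
  | const c => c
  | read i v => inp i v
  | cell a => mem a
  | op o e₁ e₂ => o.eval (e₁.eval inp mem) (e₂.eval inp mem)

/-- A program that computes an expression in cell `r`, with the cells above `r` as a stack. -/
def compile : ArithExpr V → ℕ → List (Instr V)
  | const c, r => [.const r c]
  | read i v, r => [.const r i, .read r r v]
  | cell a, r => [.const r 0, .add r r a]
  | op o e₁ e₂, r => e₁.compile r ++ (e₂.compile (r + 1) ++ [o.instr r r (r + 1)])

/-- The number of instructions that compute an expression. -/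
def cost : ArithExpr V → ℕ
  | const _ => 1
  | read _ _ => 2
  | cell _ => 2
  | op _ e₁ e₂ => e₁.cost + e₂.cost + 1

/-- All memory cells that occur in the expression lie below `r`, so that its value survives a
computation in the cells from `r` on. -/
def CellsBelow (r : ℕ) : ArithExpr V → Prop
  | const _ => True
  | read _ _ => True
  | cell a => a < r
  | op _ e₁ e₂ => e₁.CellsBelow r ∧ e₂.CellsBelow r

theorem CellsBelow.mono {r r' : ℕ} (hr : r ≤ r') {e : ArithExpr V} (h : e.CellsBelow r) :
    e.CellsBelow r' := by
  induction e with
  | const | read => trivial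
  | cell a => exact lt_of_lt_of_le h hr
  | op o e₁ e₂ ih₁ ih₂ => exact ⟨ih₁ h.1, ih₂ h.2⟩

theorem CellsBelow.eval_congr {r : ℕ} {e : ArithExpr V} (h : e.CellsBelow r) (inp : ℕ → V → ℕ)
    {mem mem' : ℕ → ℚ} (hmem : ∀ a < r, mem a = mem' a) : e.eval inp mem = e.eval inp mem' := by
  induction e with
  | const | read => rfl
  | cell a => exact hmem a h
  | op o e₁ e₂ ih₁ ih₂ => rw [eval, eval, ih₁ h.1, ih₂ h.2]

theorem length_compile (e : ArithExpr V) (r : ℕ) : (e.compile r).length = e.cost := by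
  induction e generalizing r with
  | const | read | cell => rfl
  | op o e₁ e₂ ih₁ ih₂ => simp [compile, cost, ih₁, ih₂, add_assoc]

theorem jumpFree_compile (e : ArithExpr V) (r : ℕ) : JumpFree (e.compile r) := by
  induction e generalizing r with
  | const | read | cell => simp [compile, JumpFree]
  | op o e₁ e₂ ih₁ ih₂ => exact (ih₁ r).append ((ih₂ (r + 1)).append (o.jumpFree_instr _ _ _))

theorem run_compile_of_lt (inp : ℕ → V → ℕ) (e : ArithExpr V) {a r : ℕ} (ha : a < r)
    (mem : ℕ → ℚ) : run inp (e.compile r) mem a = mem a := by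
  induction e generalizing r mem with
  | const | read | cell => simp [compile, run, exec, ha.ne]
  | op o e₁ e₂ ih₁ ih₂ =>
    rw [compile, run_append, run_append, ArithOp.run_instr, Function.update_of_ne ha.ne,
      ih₂ (ha.trans r.lt_succ_self), ih₁ ha]

theorem run_compile_self (inp : ℕ → V → ℕ) {e : ArithExpr V} {r : ℕ} (h : e.CellsBelow r)
    (mem : ℕ → ℚ) : run inp (e.compile r) mem r = e.eval inp mem := by
  induction e generalizing r mem with
  | const | read => simp [compile, run, exec, eval]
  | cell a => simp [compile, run, exec, eval, (show a ≠ r from ne_of_lt h)]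
  | op o e₁ e₂ ih₁ ih₂ =>
    have h₂ : e₂.eval inp (run inp (e₁.compile r) mem) = e₂.eval inp mem :=
      h.2.eval_congr inp fun a ha => run_compile_of_lt inp e₁ ha mem
    rw [compile, run_append, run_append, ArithOp.run_instr, Function.update_self,
      ih₂ (h.2.mono r.le_succ), run_compile_of_lt inp e₂ r.lt_succ_self, ih₁ h.1, h₂, eval]

section Fold

variable {ι : Type*}

/-- The fold of a binary operation over a finite family of expressions, starting from a constant;
the common form of `ArithExpr.sum` and `ArithExpr.prod`. -/
noncomputable def fold (o : ArithOp) (c : ℕ) (s : Finset ι) (f : ι → ArithExpr V) : ArithExpr V :=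
  s.toList.foldr (fun i e => op o (f i) e) (const c)

/-- The expression for a finite sum. -/
noncomputable abbrev sum (s : Finset ι) (f : ι → ArithExpr V) : ArithExpr V :=
  fold .add 0 s f

/-- The expression for a finite product. -/
noncomputable abbrev prod (s : Finset ι) (f : ι → ArithExpr V) : ArithExpr V :=
  fold .mul 1 s f

theorem eval_sum (inp : ℕ → V → ℕ) (mem : ℕ → ℚ) (s : Finset ι) (f : ι → ArithExpr V) :
    (sum s f).eval inp mem = ∑ i ∈ s, (f i).eval inp mem := by
  rw [← Finset.sum_map_toList, sum, fold]
  induction s.toList with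
  | nil => exact Nat.cast_zero
  | cons i l ih => rw [List.map_cons, List.sum_cons, ← ih]; rfl

theorem eval_prod (inp : ℕ → V → ℕ) (mem : ℕ → ℚ) (s : Finset ι) (f : ι → ArithExpr V) :
    (prod s f).eval inp mem = ∏ i ∈ s, (f i).eval inp mem := by
  rw [← Finset.prod_map_toList, prod, fold]
  induction s.toList with
  | nil => exact Nat.cast_one
  | cons i l ih => rw [List.map_cons, List.prod_cons, ← ih]; rfl

theorem cost_fold_le (o : ArithOp) (c : ℕ) (s : Finset ι) {f : ι → ArithExpr V} {n : ℕ}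
    (h : ∀ i ∈ s, (f i).cost ≤ n) : (fold o c s f).cost ≤ s.card * (n + 1) + 1 := by
  simp only [← Finset.mem_toList] at h
  rw [← Finset.length_toList, fold]
  generalize s.toList = l at h
  induction l with
  | nil => simp [cost]
  | cons i l ih =>
    have hi := h i List.mem_cons_self
    have hl := ih fun j hj => h j (List.mem_cons_of_mem _ hj)
    rw [List.foldr_cons, cost, List.length_cons, add_mul]
    omega

theorem cellsBelow_fold (o : ArithOp) (c : ℕ) {s : Finset ι} {f : ι → ArithExpr V} {r : ℕ}
    (h : ∀ i ∈ s, (f i).CellsBelow r) : (fold o c s f).CellsBelow r := by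
  simp only [← Finset.mem_toList] at h
  rw [fold]
  generalize s.toList = l at h
  induction l with
  | nil => trivial
  | cons i l ih =>
    exact ⟨h i List.mem_cons_self, ih fun j hj => h j (List.mem_cons_of_mem _ hj)⟩

end Fold

/-- The expression with value `1` if the symbol with index `i` for `v` has the number `c`, and `0`
otherwise: it is `1 - t / t` with `t` the difference of the numbers, and relies on `0 / 0 = 0`. -/
def eqSymbol (i : ℕ) (v : V) (c : ℕ) : ArithExpr V :=
  op .sub (const 1) (op .div (op .sub (read i v) (const c)) (op .sub (read i v) (const c)))

theorem eval_eqSymbol (inp : ℕ → V → ℕ) (mem : ℕ → ℚ) (i : ℕ) (v : V) (c : ℕ) :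
    (eqSymbol i v c).eval inp mem = if inp i v = c then 1 else 0 := by
  simp only [eqSymbol, eval, ArithOp.eval]
  split_ifs with h
  · simp [h]
  · have hne : (inp i v : ℚ) - c ≠ 0 := sub_ne_zero.2 (Nat.cast_injective.ne h)
    rw [div_self hne, Nat.cast_one, sub_self]

/-- The program that computes the expressions of a list in the cells `r, r + 1, …`. -/
def compileList : List (ArithExpr V) → ℕ → List (Instr V)
  | [], _ => []
  | e :: l, r => e.compile r ++ compileList l (r + 1)

theorem jumpFree_compileList (l : List (ArithExpr V)) (r : ℕ) : JumpFree (compileList l r) := by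
  induction l generalizing r with
  | nil => simp [compileList, JumpFree]
  | cons e l ih => exact (e.jumpFree_compile r).append (ih (r + 1))

theorem length_compileList_le {l : List (ArithExpr V)} {n : ℕ} (h : ∀ e ∈ l, e.cost ≤ n) (r : ℕ) :
    (compileList l r).length ≤ l.length * n := by
  induction l generalizing r with
  | nil => simp [compileList]
  | cons e l ih =>
    have he := h e List.mem_cons_self
    have hl := ih (fun e' he' => h e' (List.mem_cons_of_mem _ he')) (r + 1)
    rw [compileList, List.length_append, length_compile, List.length_cons, add_mul]
    omega

theorem run_compileList_of_lt (inp : ℕ → V → ℕ) (l : List (ArithExpr V)) {a r : ℕ} (ha : a < r)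
    (mem : ℕ → ℚ) : run inp (compileList l r) mem a = mem a := by
  induction l generalizing r mem with
  | nil => rfl
  | cons e l ih =>
    rw [compileList, run_append, ih (ha.trans r.lt_succ_self), run_compile_of_lt inp e ha]

theorem run_compileList_add (inp : ℕ → V → ℕ) {l : List (ArithExpr V)} {r : ℕ}
    (h : ∀ e ∈ l, e.CellsBelow r) (mem : ℕ → ℚ) {i : ℕ} (hi : i < l.length) :
    run inp (compileList l r) mem (r + i) = l[i].eval inp mem := by
  induction l generalizing r mem i with
  | nil => exact absurd hi (Nat.not_lt_zero i)
  | cons e l ih =>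
    rw [compileList, run_append]
    cases i with
    | zero =>
      rw [add_zero, run_compileList_of_lt inp l r.lt_succ_self,
        run_compile_self inp (h e List.mem_cons_self), List.getElem_cons_zero]
    | succ i =>
      have hl : ∀ e' ∈ l, e'.CellsBelow r := fun e' he' => h e' (List.mem_cons_of_mem _ he')
      rw [show r + (i + 1) = r + 1 + i by omega,
        ih (fun e' he' => (hl e' he').mono r.le_succ) _ (Nat.lt_of_succ_lt_succ hi),
        List.getElem_cons_succ]
      exact (hl _ (List.getElem_mem _)).eval_congr inp fun a ha => run_compile_of_lt inp e ha mem

end ArithExpr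

end RAM

/-! ### Concentration of empirical distributions -/

section Mass

variable {Ω : Type*} [Fintype Ω] {p : Ω → ℝ}

open Classical in
/-- The mass that a mass function gives to an event. -/
noncomputable def mass (p : Ω → ℝ) (E : Ω → Prop) : ℝ :=
  ∑ ω with E ω, p ω

theorem mass_nonneg (hp : ∀ ω, 0 ≤ p ω) (E : Ω → Prop) : 0 ≤ mass p E :=
  Finset.sum_nonneg fun ω _ => hp ω

theorem mass_mono (hp : ∀ ω, 0 ≤ p ω) {E E' : Ω → Prop} (h : ∀ ω, E ω → E' ω) :
    mass p E ≤ mass p E' := by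
  classical
  exact Finset.sum_le_sum_of_subset_of_nonneg (Finset.monotone_filter_right _ fun ω _ => h ω)
    fun ω _ _ => hp ω

theorem IsDistribution.mass_not (hp : IsDistribution p) (E : Ω → Prop) :
    mass p (fun ω => ¬ E ω) = 1 - mass p E := by
  classical
  rw [eq_sub_iff_add_eq', ← hp.2, ← Finset.sum_filter_add_sum_filter_not _ E]
  simp only [mass]

theorem IsDistribution.mass_eq_one (hp : IsDistribution p) {E : Ω → Prop} (h : ∀ ω, E ω) :
    mass p E = 1 := by
  classical
  rw [mass, Finset.filter_true_of_mem fun ω _ => h ω, hp.2]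

theorem mass_exists_le (hp : ∀ ω, 0 ≤ p ω) {ι : Type*} [Fintype ι] (E : ι → Ω → Prop) :
    mass p (fun ω => ∃ i, E i ω) ≤ ∑ i, mass p (E i) := by
  classical
  simp only [mass, Finset.sum_filter]
  rw [Finset.sum_comm]
  refine Finset.sum_le_sum fun ω _ => ?_
  have h₀ : ∀ i ∈ Finset.univ, 0 ≤ if E i ω then p ω else 0 := fun i _ =>
    ite_nonneg (hp ω) le_rfl
  split_ifs with h
  · obtain ⟨i, hi⟩ := h
    exact (if_pos hi).ge.trans (Finset.single_le_sum h₀ (Finset.mem_univ i))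
  · exact Finset.sum_nonneg h₀

theorem iidProb_eq_mass (p : Ω → ℝ) (m : ℕ) (E : (Fin m → Ω) → Prop) :
    iidProb p m E = mass (fun s => ∏ i, p (s i)) E :=
  rfl

theorem IsDistribution.pi (hp : IsDistribution p) (m : ℕ) :
    IsDistribution fun s : Fin m → Ω => ∏ i, p (s i) :=
  ⟨fun _ => Finset.prod_nonneg fun _ _ => hp.1 _, by
    rw [← Fintype.sum_pow, hp.2, one_pow]⟩

open Classical in
/-- The empirical distribution of a sequence of samples (the zero function if there are none). -/
noncomputable def empirical {m : ℕ} (s : Fin m → Ω) (ω : Ω) : ℝ :=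
  (Finset.card {j | s j = ω} : ℝ) / m

open Classical in
theorem mass_empirical {m : ℕ} (s : Fin m → Ω) (E : Ω → Prop) :
    mass (empirical s) E = (Finset.card {j | E (s j)} : ℝ) / m := by
  simp only [mass, empirical, ← Finset.sum_div]
  rw [Finset.card_eq_sum_card_fiberwise (f := s) (t := {ω | E ω}) fun j hj => by simpa using hj]
  push_cast
  congr 1
  refine Finset.sum_congr rfl fun ω hω => ?_
  congr 2
  ext j
  simp only [Finset.mem_filter, Finset.mem_univ, true_and] at hω ⊢
  exact ⟨fun h => ⟨h ▸ hω, h⟩, And.right⟩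

end Mass

section Chernoff

variable {Ω : Type*} [Fintype Ω] {p : Ω → ℝ}

theorem iidProb_le_exp_mul_pow (hp : ∀ ω, 0 ≤ p ω) (m : ℕ) (f : Ω → ℝ) (a : ℝ) :
    iidProb p m (fun s => a ≤ ∑ j, f (s j)) ≤
      Real.exp (-a) * (∑ ω, p ω * Real.exp (f ω)) ^ m := by
  classical
  rw [iidProb, Finset.sum_filter, Fintype.sum_pow, Finset.mul_sum]
  refine Finset.sum_le_sum fun s _ => ?_
  have h₀ : 0 ≤ ∏ i, p (s i) := Finset.prod_nonneg fun i _ => hp _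
  rw [Finset.prod_mul_distrib, ← Real.exp_sum, mul_left_comm, ← Real.exp_add]
  split_ifs with h
  · exact le_mul_of_one_le_right h₀ (Real.one_le_exp (by linarith))
  · positivity

open Classical in
theorem IsDistribution.sum_mul_exp_ite_le (hp : IsDistribution p) (E : Ω → Prop) {u : ℝ}
    (hu : |u| ≤ 1) :
    ∑ ω, p ω * Real.exp (if E ω then u else 0) ≤ Real.exp (mass p E * (u + u ^ 2)) := by
  have hexp : Real.exp u - 1 ≤ u + u ^ 2 := by
    linarith [(abs_le.1 (Real.abs_exp_sub_one_sub_id_le hu)).2]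
  calc ∑ ω, p ω * Real.exp (if E ω then u else 0)
      = ∑ ω, (p ω + (if E ω then p ω else 0) * (Real.exp u - 1)) :=
        Finset.sum_congr rfl fun ω _ => by split_ifs <;> ring_nf; simp
    _ = mass p E * (Real.exp u - 1) + 1 := by
        rw [Finset.sum_add_distrib, ← Finset.sum_mul, ← Finset.sum_filter, hp.2, add_comm, mass]
    _ ≤ mass p E * (u + u ^ 2) + 1 := by gcongr; exact mass_nonneg hp.1 E
    _ ≤ Real.exp (mass p E * (u + u ^ 2)) := Real.add_one_le_exp _

theorem IsDistribution.iidProb_le_mul_mass_empirical_sub_le (hp : IsDistribution p) (m : ℕ)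
    (E : Ω → Prop) {u : ℝ} (hu : |u| ≤ 1) (b : ℝ) :
    iidProb p m (fun s => b ≤ u * (m * (mass (empirical s) E - mass p E))) ≤
      Real.exp (m * mass p E * u ^ 2 - b) := by
  classical
  have hsum : ∀ s : Fin m → Ω,
      ∑ j, (if E (s j) then u else 0) = u * (m * mass (empirical s) E) := fun s => by
    rcases m.eq_zero_or_pos with rfl | hm
    · simp
    · rw [mass_empirical, mul_div_cancel₀ _ (Nat.cast_ne_zero.2 hm.ne'), ← Finset.sum_filter,
        Finset.sum_const, nsmul_eq_mul, mul_comm]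
  calc iidProb p m (fun s => b ≤ u * (m * (mass (empirical s) E - mass p E)))
      ≤ iidProb p m fun s => b + u * (m * mass p E) ≤ ∑ j, if E (s j) then u else 0 :=
        mass_mono (hp.pi m).1 fun s hs => by rw [hsum]; linarith
    _ ≤ Real.exp (-(b + u * (m * mass p E))) * Real.exp (mass p E * (u + u ^ 2)) ^ m := by
        refine (iidProb_le_exp_mul_pow hp.1 m (fun ω => if E ω then u else 0) _).trans
          (mul_le_mul_of_nonneg_left (pow_le_pow_left₀ ?_ (hp.sum_mul_exp_ite_le E hu) m)
            (Real.exp_pos _).le)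
        exact Finset.sum_nonneg fun ω _ => mul_nonneg (hp.1 ω) (Real.exp_pos _).le
    _ = Real.exp (m * mass p E * u ^ 2 - b) := by
        rw [← Real.exp_nat_mul, ← Real.exp_add]
        congr 1
        ring

theorem IsDistribution.iidProb_lt_abs_mass_empirical_sub_le (hp : IsDistribution p) (m : ℕ)
    (E : Ω → Prop) {q η : ℝ} (hq : mass p E ≤ q) (hη₀ : 0 ≤ η) (hη₂ : η ≤ 2) :
    iidProb p m (fun s => η * q < |mass (empirical s) E - mass p E|) ≤
      2 * Real.exp (-(m * q * η ^ 2 / 4)) := by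
  have hside : ∀ u : ℝ, |u| = η / 2 → iidProb p m
      (fun s => η / 2 * (m * (η * q)) ≤ u * (m * (mass (empirical s) E - mass p E))) ≤
      Real.exp (-(m * q * η ^ 2 / 4)) := fun u hu => by
    refine (hp.iidProb_le_mul_mass_empirical_sub_le m E (hu.trans_le (by linarith)) _).trans
      (Real.exp_le_exp.2 ?_)
    have hmq : m * mass p E * η ^ 2 ≤ m * q * η ^ 2 := by gcongr
    rw [← sq_abs, hu]
    linarith
  have hhalf : |η / 2| = η / 2 := abs_of_nonneg (by positivity)
  calc iidProb p m (fun s => η * q < |mass (empirical s) E - mass p E|)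
      ≤ iidProb p m fun s => ∃ i : Fin 2, η / 2 * (m * (η * q)) ≤
          ![η / 2, -(η / 2)] i * (m * (mass (empirical s) E - mass p E)) := by
        refine mass_mono (hp.pi m).1 fun s hs => ?_
        rcases lt_abs.1 hs with hs | hs
        · exact ⟨0, mul_le_mul_of_nonneg_left (by gcongr) (by positivity)⟩
        · refine ⟨1, ?_⟩
          simp only [Matrix.cons_val_one, Matrix.cons_val_fin_one]
          rw [neg_mul, ← mul_neg, ← mul_neg]
          gcongr
    _ ≤ 2 * Real.exp (-(m * q * η ^ 2 / 4)) := by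
        refine (mass_exists_le (hp.pi m).1 _).trans ?_
        rw [Fin.sum_univ_two, two_mul]
        exact add_le_add (hside _ hhalf) (hside _ ((abs_neg _).trans hhalf))

theorem IsDistribution.one_sub_le_iidProb_forall (hp : IsDistribution p) (m : ℕ)
    {ι : Type*} [Fintype ι] {E : ι → Ω → Prop} {q : ι → ℝ} (hq : ∀ i, mass p (E i) ≤ q i)
    {β η : ℝ} (hβ : ∀ i, β ≤ q i) (hη₀ : 0 ≤ η) (hη₂ : η ≤ 2) :
    1 - Fintype.card ι * (2 * Real.exp (-(m * β * η ^ 2 / 4))) ≤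
      iidProb p m fun s => ∀ i, |mass (empirical s) (E i) - mass p (E i)| ≤ η * q i := by
  have hbad : mass (fun s : Fin m → Ω => ∏ i, p (s i)) (fun s => ¬ ∀ i,
      |mass (empirical s) (E i) - mass p (E i)| ≤ η * q i) ≤
      Fintype.card ι * (2 * Real.exp (-(m * β * η ^ 2 / 4))) := by
    simp only [not_forall, not_le]
    refine (mass_exists_le (hp.pi m).1 _).trans ?_
    rw [← nsmul_eq_mul]
    refine Finset.sum_le_card_nsmul _ _ _ fun i _ =>
      (hp.iidProb_lt_abs_mass_empirical_sub_le m (E i) (hq i) hη₀ hη₂).trans ?_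
    gcongr
    exact hβ i
  rw [(hp.pi m).mass_not, ← iidProb_eq_mass] at hbad
  linarith

end Chernoff

/-! ### Graphs, sums and integrals -/

namespace ADMG

variable {V : Type*} (G : ADMG V)

/-- An injective ranking of the vertices along which all directed edges go up, that is, a
topological ordering of `G` in which the positions may have gaps. -/
structure IsTopologicalOrder (r : V → ℕ) : Prop where
  injective : Function.Injective r
  lt_of_directed : ∀ ⦃a b⦄, G.directed a b → r a < r b

theorem exists_isTopologicalOrder [Finite V] : ∃ r, G.IsTopologicalOrder r := by
  let order : PartialOrder V :=
    { le := Relation.ReflTransGen G.directed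
      le_refl := fun _ => .refl
      le_trans := fun _ _ _ => .trans
      le_antisymm := fun a b hab hba => by
        rcases Relation.reflTransGen_iff_eq_or_transGen.1 hab with h | h
        · exact h.symm
        · exact absurd (h.trans_left hba) (G.acyclic a) }
  let _ : Fintype (LinearExtension V) := Fintype.ofFinite V
  let position := (Fintype.orderIsoFinOfCardEq (LinearExtension V) rfl).symm
  refine ⟨fun v => position v, Fin.val_injective.comp position.injective, fun a b hab => ?_⟩
  have hle : toLinearExtension a ≤ toLinearExtension b :=
    toLinearExtension.monotone (Relation.ReflTransGen.single hab)
  have hne : a ≠ b := fun h => G.acyclic a (.single (h ▸ hab))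
  exact position.strictMono (hle.lt_of_ne hne)

/-- A set of vertices that contains all parents of its elements. -/
def IsAncestral (D : Finset V) : Prop :=
  ∀ ⦃a b⦄, G.directed a b → b ∈ D → a ∈ D

/-- A set of vertices that no bidirected edge leaves, that is, a union of c-components. -/
def IsCClosed (S : Finset V) : Prop :=
  ∀ ⦃a b⦄, G.bidirected.Adj a b → a ∈ S → b ∈ S

theorem mem_cComponent_self [Fintype V] (X : V) : X ∈ G.cComponent X := by
  simp [cComponent]

theorem isCClosed_cComponent [Fintype V] (X : V) : G.IsCClosed (G.cComponent X) := by
  intro a b hab ha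
  simp only [cComponent, Finset.mem_filter, Finset.mem_univ, true_and] at ha ⊢
  exact ha.trans hab.reachable

variable {G} [Fintype V]

theorem mem_paPlus [DecidableEq V] {S : Finset V} {a : V} :
    a ∈ G.paPlus S ↔ a ∈ S ∨ ∃ b ∈ S, G.directed a b := by
  simp [paPlus, parents]

theorem subset_paPlus [DecidableEq V] (S : Finset V) : S ⊆ G.paPlus S :=
  Finset.subset_union_left

theorem IsTopologicalOrder.isAncestral_filter_lt {r : V → ℕ} (hr : G.IsTopologicalOrder r)
    (n : ℕ) : G.IsAncestral {v | r v < n} := by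
  intro a b hab hb
  simp only [Finset.mem_filter, Finset.mem_univ, true_and] at hb ⊢
  exact (hr.lt_of_directed hab).trans hb

theorem IsTopologicalOrder.isAncestral_filter_le {r : V → ℕ} (hr : G.IsTopologicalOrder r)
    (n : ℕ) : G.IsAncestral {v | r v ≤ n} := by
  intro a b hab hb
  simp only [Finset.mem_filter, Finset.mem_univ, true_and] at hb ⊢
  exact (hr.lt_of_directed hab).le.trans hb

end ADMG

theorem filter_le_eq_insert_filter_lt {V : Type*} [DecidableEq V] {r : V → ℕ}
    (hr : Function.Injective r) {T : Finset V} {i : V} (hi : i ∈ T) :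
    {v ∈ T | r v ≤ r i} = insert i {v ∈ T | r v < r i} := by
  ext v
  simp only [Finset.mem_filter, Finset.mem_insert, le_iff_lt_or_eq, hr.eq_iff]
  grind

theorem eq_mul_prod_of_insert_eq_mul {V R : Type*} [DecidableEq V] [CommMonoid R] {r : V → ℕ}
    (hr : Function.Injective r) (f : Finset V → R) (ρ : V → R) (S : Finset V)
    (h : ∀ i ∈ S, f (insert i {v ∈ S | r v < r i}) = f {v ∈ S | r v < r i} * ρ i) :
    f S = f ∅ * ∏ i ∈ S, ρ i := by
  induction S using Finset.induction_on_max_value r with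
  | empty => simp
  | insert a s ha hmax ih =>
    have hlt : ∀ i ∈ s, r i < r a := fun i hi =>
      (hmax i hi).lt_of_ne (hr.ne (ne_of_mem_of_not_mem hi ha))
    have hs : ∀ i ∈ s, f (insert i {v ∈ s | r v < r i}) = f {v ∈ s | r v < r i} * ρ i := by
      intro i hi
      have := h i (Finset.mem_insert_of_mem hi)
      rwa [Finset.filter_insert, if_neg (hlt i hi).not_gt] at this
    have hfa := h a (Finset.mem_insert_self a s)
    rw [Finset.filter_insert, if_neg (lt_irrefl _), Finset.filter_true_of_mem hlt, ih hs] at hfa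
    rw [hfa, Finset.prod_insert ha, mul_assoc, mul_comm (ρ a)]

theorem sum_sum_update {V A R : Type*} [Fintype V] [DecidableEq V] [Fintype A] [CommSemiring R]
    (i : V) (h : (V → A) → R) :
    ∑ σ : V → A, ∑ a, h (Function.update σ i a) = Fintype.card A * ∑ σ, h σ := by
  let swap : (V → A) × A → (V → A) × A := fun x => (Function.update x.1 i x.2, x.1 i)
  have hswap : Function.Involutive swap := fun x => by simp [swap]
  have e : ∑ x : (V → A) × A, h (Function.update x.1 i x.2) = ∑ x : (V → A) × A, h x.1 :=
    Fintype.sum_equiv (hswap.toPerm swap) _ _ fun x => rfl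
  rw [Fintype.sum_prod_type, Fintype.sum_prod_type] at e
  simpa [Finset.mul_sum] using e

open MeasureTheory in
theorem integral_mul_of_dependsOn_compl {ι : Type*} [Fintype ι] {Ω : ι → Type*}
    [∀ i, MeasurableSpace (Ω i)] (μ : ∀ i, Measure (Ω i)) [∀ i, IsProbabilityMeasure (μ i)]
    {f g : (∀ i, Ω i) → ℝ} {s : Set ι} (hf : DependsOn f s) (hg : DependsOn g sᶜ) :
    ∫ u, f u * g u ∂Measure.pi μ = (∫ u, f u ∂Measure.pi μ) * ∫ u, g u ∂Measure.pi μ := by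
  classical
  have : ∀ i, Nonempty (Ω i) := fun i => nonempty_of_isProbabilityMeasure (μ i)
  let u₀ : ∀ i, Ω i := fun i => Classical.arbitrary _
  set e := MeasurableEquiv.piEquivPiSubtypeProd Ω (· ∈ s) with he
  have integral_eq : ∀ k : (∀ i, Ω i) → ℝ, ∫ u, k u ∂Measure.pi μ = ∫ z, k (e.symm z)
      ∂(Measure.pi fun i : s => μ i).prod (Measure.pi fun i : {i // i ∉ s} => μ i) := fun k =>
    (((measurePreserving_piEquivPiSubtypeProd μ (· ∈ s)).symm e).integral_comp' k).symm
  have hf' : ∀ z, f (e.symm z) = f (e.symm (z.1, (e u₀).2)) := fun z => hf fun i hi => by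
    simp [he, MeasurableEquiv.piEquivPiSubtypeProd, Equiv.piEquivPiSubtypeProd, hi]
  have hg' : ∀ z, g (e.symm z) = g (e.symm ((e u₀).1, z.2)) := fun z => hg fun i hi => by
    simp [he, MeasurableEquiv.piEquivPiSubtypeProd, Equiv.piEquivPiSubtypeProd,
      show i ∉ s from hi]
  rw [integral_eq, integral_eq f, integral_eq g]
  simp_rw [hf', hg']
  rw [integral_prod_mul (fun a => f (e.symm (a, (e u₀).2))) fun b => g (e.symm ((e u₀).1, b)),
    integral_fun_fst fun a => f (e.symm (a, (e u₀).2)),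
    integral_fun_snd fun b => g (e.symm ((e u₀).1, b))]
  simp

/-! ### Causal Bayes nets: partial laws and the c-component factorization -/

namespace CausalBayesNet

variable {V : Type u} {A : Type v} [Fintype A] {G : ADMG V} (M : CausalBayesNet.{u, v, w} G A)

instance : MeasureTheory.IsProbabilityMeasure M.hiddenLaw :=
  inferInstanceAs (MeasureTheory.IsProbabilityMeasure (MeasureTheory.Measure.pi M.prior))

/-- The probability of the values of the variables in `T` when all other variables are set by an
intervention, called `Q[T]` in the literature. It takes a full assignment, but depends only on the
values of the variables in `T` and of their parents. -/
noncomputable def partialLaw (T : Finset V) (σ : V → A) : ℝ :=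
  ∫ u, ∏ v ∈ T, M.factor σ u v ∂M.hiddenLaw

theorem obs_eq_partialLaw_univ [Fintype V] : M.obs = M.partialLaw Finset.univ :=
  rfl

theorem partialLaw_empty (σ : V → A) : M.partialLaw ∅ σ = 1 := by
  simp [partialLaw]

theorem factor_nonneg (σ : V → A) (u : ∀ h, M.Val h) (v : V) : 0 ≤ M.factor σ u v :=
  M.mech_nonneg _ _ _ _

theorem factor_le_one (σ : V → A) (u : ∀ h, M.Val h) (v : V) : M.factor σ u v ≤ 1 := by
  rw [← M.mech_sum v (fun p => σ p.1) fun h => u h.1]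
  exact Finset.single_le_sum (f := fun a => M.mech v (fun p => σ p.1) (fun h => u h.1) a)
    (fun a _ => M.mech_nonneg _ _ _ _) (Finset.mem_univ (σ v))

theorem measurable_factor (σ : V → A) (v : V) : Measurable fun u => M.factor σ u v :=
  (M.measurable_mech v _ _).comp (measurable_pi_lambda _ fun _ => measurable_pi_apply _)

theorem partialLaw_nonneg (T : Finset V) (σ : V → A) : 0 ≤ M.partialLaw T σ :=
  MeasureTheory.integral_nonneg fun u => Finset.prod_nonneg fun v _ => M.factor_nonneg σ u v

theorem integrable_prod_factor (T : Finset V) (σ : V → A) :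
    MeasureTheory.Integrable (fun u => ∏ v ∈ T, M.factor σ u v) M.hiddenLaw := by
  refine .of_bound (Finset.measurable_prod _ fun v _ =>
    M.measurable_factor σ v).aestronglyMeasurable 1 (.of_forall fun u => ?_)
  rw [Real.norm_of_nonneg (Finset.prod_nonneg fun v _ => M.factor_nonneg σ u v)]
  exact Finset.prod_le_one (fun v _ => M.factor_nonneg σ u v) fun v _ => M.factor_le_one σ u v

theorem dependsOn_factor (u : ∀ h, M.Val h) (v : V) :
    DependsOn (fun σ => M.factor σ u v) {w | w = v ∨ G.directed w v} := by
  intro σ σ' h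
  simp only [factor, h v (.inl rfl), fun p : {p // G.directed p v} => h p.1 (.inr p.2)]

theorem dependsOn_partialLaw [Fintype V] [DecidableEq V] (T : Finset V) :
    DependsOn (M.partialLaw T) (G.paPlus T) := by
  intro σ σ' h
  refine MeasureTheory.integral_congr_ae (.of_forall fun u => Finset.prod_congr rfl fun v hv => ?_)
  refine M.dependsOn_factor u v fun w hw => h w ?_
  rcases hw with rfl | hw
  · exact ADMG.subset_paPlus T hv
  · exact ADMG.mem_paPlus.2 (.inr ⟨v, hv, hw⟩)

theorem dependsOn_partialLaw_compl {T : Finset V} {i : V} (hi : i ∉ T)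
    (hchild : ∀ v ∈ T, ¬ G.directed i v) : DependsOn (M.partialLaw T) {i}ᶜ := by
  intro σ σ' h
  refine MeasureTheory.integral_congr_ae (.of_forall fun u => Finset.prod_congr rfl fun v hv => ?_)
  refine M.dependsOn_factor u v fun w hw => h w ?_
  rintro rfl
  exact hw.elim (ne_of_mem_of_not_mem hv hi).symm (hchild v hv)

theorem sum_factor_update [DecidableEq V] (σ : V → A) (u : ∀ h, M.Val h) (i : V) :
    ∑ a, M.factor (Function.update σ i a) u i = 1 := by
  have hparents : ∀ a (p : {p // G.directed p i}), Function.update σ i a p.1 = σ p.1 :=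
    fun a p => Function.update_of_ne (by
      rintro hp
      exact G.acyclic i (.single (by simpa only [hp] using p.2))) _ _
  simp only [factor, Function.update_self, hparents, M.mech_sum]

theorem sum_partialLaw_insert [DecidableEq V] {T : Finset V} {i : V} (hi : i ∉ T)
    (hchild : ∀ v ∈ T, ¬ G.directed i v) (σ : V → A) :
    ∑ a, M.partialLaw (insert i T) (Function.update σ i a) = M.partialLaw T σ := by
  unfold partialLaw
  rw [← MeasureTheory.integral_finsetSum _ fun a _ => M.integrable_prod_factor _ _]
  refine MeasureTheory.integral_congr_ae (.of_forall fun u => ?_)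
  have hT : ∀ a, ∏ v ∈ T, M.factor (Function.update σ i a) u v = ∏ v ∈ T, M.factor σ u v :=
    fun a => Finset.prod_congr rfl fun v hv => M.dependsOn_factor u v fun w hw =>
      Function.update_of_ne (by
        rintro rfl
        exact hw.elim (ne_of_mem_of_not_mem hv hi).symm (hchild v hv)) _ _
  simp only [Finset.prod_insert hi, hT]
  rw [← Finset.sum_mul, M.sum_factor_update, one_mul]

theorem sum_mul_partialLaw_insert [Fintype V] [DecidableEq V] {T : Finset V} {i : V} (hi : i ∉ T)
    (hchild : ∀ v ∈ T, ¬ G.directed i v) {f : (V → A) → ℝ} (hf : DependsOn f {i}ᶜ) :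
    (∑ σ, f σ * M.partialLaw (insert i T) σ) * Fintype.card A =
      ∑ σ, f σ * M.partialLaw T σ := by
  have hf' : ∀ σ a, f (Function.update σ i a) = f σ := fun σ a =>
    hf fun v hv => Function.update_of_ne hv _ _
  rw [mul_comm, ← sum_sum_update i]
  refine Finset.sum_congr rfl fun σ _ => ?_
  simp_rw [hf', ← Finset.mul_sum, M.sum_partialLaw_insert hi hchild]

theorem sum_mul_partialLaw_mul_pow [Fintype V] [DecidableEq V] {U D : Finset V} (hU : U ⊆ D)
    (hchild : ∀ i ∈ U, ∀ v ∈ D \ U, ¬ G.directed i v) {f : (V → A) → ℝ}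
    (hf : DependsOn f (U : Set V)ᶜ) :
    (∑ σ, f σ * M.partialLaw D σ) * (Fintype.card A : ℝ) ^ U.card =
      ∑ σ, f σ * M.partialLaw (D \ U) σ := by
  obtain ⟨r, hr⟩ := G.exists_isTopologicalOrder
  induction U using Finset.induction_on_max_value r generalizing D with
  | empty => simp
  | insert a U ha hmax ih =>
    have haD : a ∈ D := hU (Finset.mem_insert_self a U)
    have hchild_a : ∀ v ∈ D.erase a, ¬ G.directed a v := fun v hv hav => by
      by_cases hvU : v ∈ U
      · exact (hr.lt_of_directed hav).not_ge (hmax v hvU)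
      · rw [Finset.mem_erase] at hv
        exact hchild a (Finset.mem_insert_self a U) v (by simp [hv, hvU]) hav
    have hsdiff : D.erase a \ U = D \ insert a U := by grind
    have hfa : DependsOn f {a}ᶜ := hf.mono (by simp)
    have hfU : DependsOn f (U : Set V)ᶜ := hf.mono (by simp)
    have hsum := M.sum_mul_partialLaw_insert (Finset.notMem_erase a D) hchild_a hfa
    rw [Finset.insert_erase haD] at hsum
    rw [Finset.card_insert_of_notMem ha, pow_succ', ← mul_assoc, hsum, ← hsdiff]
    refine ih (by grind) (fun i hi v hv => ?_) hfU
    exact hchild i (Finset.mem_insert_of_mem hi) v (hsdiff ▸ hv)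

theorem isDistribution_obs [Fintype V] [DecidableEq V] [Nonempty A] : IsDistribution M.obs := by
  refine ⟨M.partialLaw_nonneg _, ?_⟩
  have h := M.sum_mul_partialLaw_mul_pow (f := fun _ => 1) (U := .univ) subset_rfl (by simp)
    ((dependsOn_const 1).mono (Set.empty_subset _))
  have hA : (Fintype.card A : ℝ) ≠ 0 := by exact_mod_cast Fintype.card_ne_zero
  simpa [partialLaw_empty, hA, obs_eq_partialLaw_univ] using h

open Classical in
/-- The causal Bayes net after the intervention that sets `X` to `x`. The edges into `X` are kept;
the new mechanism of `X` ignores them. -/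
noncomputable def intervene (X : V) (x : A) : CausalBayesNet.{u, v, w} G A where
  __ := M
  mech v pa u a := if v = X then if a = x then 1 else 0 else M.mech v pa u a
  measurable_mech v pa a := by
    split_ifs
    exacts [measurable_const, measurable_const, M.measurable_mech v pa a]
  mech_nonneg v pa u a := by
    split_ifs
    exacts [zero_le_one, le_rfl, M.mech_nonneg v pa u a]
  mech_sum v pa u := by
    split_ifs
    exacts [by simp, M.mech_sum v pa u]

theorem interv_eq_obs_intervene [Fintype V] [DecidableEq V] [DecidableEq A] (X : V) (x : A) :
    M.interv X x = (M.intervene X x).obs := by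
  funext σ
  have hX : ∀ u, (M.intervene X x).factor σ u X = if σ X = x then 1 else 0 := fun u => by
    simp [factor, intervene]
  have hne : ∀ u, ∀ v ∈ Finset.univ.erase X, (M.intervene X x).factor σ u v = M.factor σ u v :=
    fun u v hv => by simp [factor, intervene, Finset.ne_of_mem_erase hv]
  simp only [obs, ← Finset.mul_prod_erase _ _ (Finset.mem_univ X), hX,
    Finset.prod_congr rfl (hne _)]
  split_ifs with h
  · simp only [interv, h, if_true, one_mul]
    rfl
  · simp [interv, h]

theorem isDistribution_interv [Fintype V] [DecidableEq V] [DecidableEq A] [Nonempty A] (X : V)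
    (x : A) : IsDistribution (M.interv X x) :=
  M.interv_eq_obs_intervene X x ▸ (M.intervene X x).isDistribution_obs

variable {M} in
theorem mem_of_mem_ends_of_isCClosed {S : Finset V} (hS : G.IsCClosed S) {h : M.Hidden} {a b : V}
    (ha : a ∈ M.ends h) (hb : b ∈ M.ends h) (haS : a ∈ S) : b ∈ S := by
  rcases eq_or_ne a b with rfl | hab
  · exact haS
  · have hmem : M.ends h ∈ G.bidirected.edgeSet := M.range_ends ▸ Set.mem_range_self h
    rw [(Sym2.mem_and_mem_iff hab).1 ⟨ha, hb⟩, SimpleGraph.mem_edgeSet] at hmem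
    exact hS hmem haS

theorem dependsOn_prod_factor (σ : V → A) (T : Finset V) :
    DependsOn (fun u => ∏ v ∈ T, M.factor σ u v) {h | ∃ v ∈ M.ends h, v ∈ T} :=
  fun u u' hu => Finset.prod_congr rfl fun v hv => by
    simp only [factor, fun h : {h // v ∈ M.ends h} => hu h.1 ⟨v, h.2, hv⟩]

theorem partialLaw_union [DecidableEq V] {S T₁ T₂ : Finset V} (hS : G.IsCClosed S) (h₁ : T₁ ⊆ S)
    (h₂ : Disjoint T₂ S) (σ : V → A) :
    M.partialLaw (T₁ ∪ T₂) σ = M.partialLaw T₁ σ * M.partialLaw T₂ σ := by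
  simp only [partialLaw, Finset.prod_union (Finset.disjoint_of_subset_left h₁ h₂.symm)]
  refine integral_mul_of_dependsOn_compl M.prior (s := {h | ∃ v ∈ M.ends h, v ∈ S})
    ((M.dependsOn_prod_factor σ T₁).mono ?_) ((M.dependsOn_prod_factor σ T₂).mono ?_)
  · exact fun h ⟨v, hv, hvT⟩ => ⟨v, hv, h₁ hvT⟩
  · rintro h ⟨v, hv, hvT⟩ ⟨w, hw, hwS⟩
    exact Finset.disjoint_left.1 h₂ hvT (mem_of_mem_ends_of_isCClosed hS hw hv hwS)

theorem obs_eq_partialLaw_mul_compl [Fintype V] [DecidableEq V] {S : Finset V}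
    (hS : G.IsCClosed S) (σ : V → A) :
    M.obs σ = M.partialLaw S σ * M.partialLaw Sᶜ σ := by
  rw [← M.partialLaw_union hS subset_rfl disjoint_compl_left, Finset.union_compl,
    obs_eq_partialLaw_univ]

end CausalBayesNet

/-! ### The plug-in functional -/

/-- Extension of an assignment on `S` to all variables by the constant value `x`. -/
noncomputable def extend {V A : Type*} {S : Finset V} (x : A) (w : S → A) : V → A :=
  Function.extend Subtype.val w fun _ => x

theorem forall_mem_eq_extend_iff {V A : Type*} {S : Finset V} (x : A) (w : S → A) (σ : V → A) :
    (∀ v ∈ S, σ v = extend x w v) ↔ (fun v : S => σ v) = w := by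
  rw [funext_iff, Subtype.forall]
  refine forall₂_congr fun v hv => ?_
  rw [extend, Subtype.val_injective.extend_apply w _ ⟨v, hv⟩]

section Functional

variable {V : Type*} [Fintype V] [DecidableEq V] {A : Type*} [Fintype A]

/-- The probability of agreeing with `τ` on `S`. Only the values of `τ` on `S` matter; taking a full
assignment makes nested sets of variables comparable without coercions. -/
noncomputable def cyl (p : (V → A) → ℝ) (S : Finset V) (τ : V → A) : ℝ :=
  mass p fun σ => ∀ v ∈ S, σ v = τ v

/-- The probability of agreeing with `ρ` on `F` and with `τ` on `Z`. -/
noncomputable def joint (p : (V → A) → ℝ) (F Z : Finset V) (ρ τ : V → A) : ℝ :=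
  mass p fun σ => (∀ v ∈ F, σ v = ρ v) ∧ ∀ v ∈ Z, σ v = τ v

/-- The product, over `v ∈ S`, of the conditional probabilities of the value of `v` given the values
of the variables in `Z` of smaller rank. -/
noncomputable def chainProd (r : V → ℕ) (S Z : Finset V) (p : (V → A) → ℝ) (τ : V → A) : ℝ :=
  ∏ v ∈ S, cyl p {u ∈ Z | r u ≤ r v} τ / cyl p {u ∈ Z | r u < r v} τ

/-- The estimated density, on the event that `X` has the value `x`, of the interventional with
respect to the observational distribution. It does not involve `x`. -/
noncomputable def density (r : V → ℕ) (S Z : Finset V) (X : V) (p : (V → A) → ℝ) (τ : V → A) : ℝ :=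
  (∑ a, chainProd r S Z p (Function.update τ X a)) / chainProd r S Z p τ

/-- The plug-in functional: the marginal on `F` of the interventional distribution, as a function of
the observational distribution `p`. -/
noncomputable def plugIn [DecidableEq A] (r : V → ℕ) (S Z F : Finset V) (X : V) (x : A)
    (p : (V → A) → ℝ) (w : F → A) : ℝ :=
  ∑ z : Z → A with extend x z X = x,
    joint p F Z (extend x w) (extend x z) * density r S Z X p (extend x z)

theorem cyl_nonneg {p : (V → A) → ℝ} (hp : ∀ σ, 0 ≤ p σ) (S : Finset V) (τ : V → A) :
    0 ≤ cyl p S τ :=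
  mass_nonneg hp _

theorem cyl_anti {p : (V → A) → ℝ} (hp : ∀ σ, 0 ≤ p σ) {S T : Finset V} (h : S ⊆ T) (τ : V → A) :
    cyl p T τ ≤ cyl p S τ :=
  mass_mono hp fun _ hσ v hv => hσ v (h hv)

theorem dependsOn_cyl (p : (V → A) → ℝ) (S : Finset V) : DependsOn (cyl p S) S :=
  fun τ τ' h => congrArg (mass p) <| funext fun σ => propext <|
    forall₂_congr fun v hv => by rw [h v hv]

theorem dependsOn_chainProd (r : V → ℕ) (S Z : Finset V) (p : (V → A) → ℝ) :
    DependsOn (chainProd r S Z p) Z := by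
  intro τ τ' h
  have hcyl : ∀ T ⊆ Z, cyl p T τ = cyl p T τ' := fun T hT =>
    dependsOn_cyl p T fun v hv => h v (hT hv)
  exact Finset.prod_congr rfl fun v _ => by
    rw [hcyl _ (Finset.filter_subset _ Z), hcyl _ (Finset.filter_subset _ Z)]

theorem dependsOn_density (r : V → ℕ) (S Z : Finset V) (X : V) (p : (V → A) → ℝ) :
    DependsOn (density r S Z X p) Z := by
  intro τ τ' h
  have hupdate : ∀ a, chainProd r S Z p (Function.update τ X a) =
      chainProd r S Z p (Function.update τ' X a) := fun a =>
    dependsOn_chainProd r S Z p fun v hv => by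
      by_cases hX : v = X
      · simp [hX]
      · simp [hX, h v hv]
  simp only [density, hupdate, dependsOn_chainProd r S Z p h]

theorem cyl_mul_left {f : (V → A) → ℝ} {T : Finset V} (hf : DependsOn f T) (g : (V → A) → ℝ)
    (τ : V → A) : cyl (fun σ => f σ * g σ) T τ = f τ * cyl g T τ := by
  rw [cyl, cyl, mass, mass, Finset.mul_sum]
  refine Finset.sum_congr rfl fun σ hσ => ?_
  rw [hf (by simpa using hσ)]

theorem sum_joint_mul (p : (V → A) → ℝ) (F Z : Finset V) (x : A) (ρ : V → A) {f : (V → A) → ℝ}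
    (hf : DependsOn f Z) :
    ∑ z : Z → A, joint p F Z ρ (extend x z) * f (extend x z) =
      cyl (fun σ => p σ * f σ) F ρ := by
  classical
  simp only [joint, cyl, mass, forall_mem_eq_extend_iff, Finset.sum_filter, Finset.sum_mul]
  rw [Finset.sum_comm]
  refine Finset.sum_congr rfl fun σ _ => ?_
  rw [Finset.sum_eq_single_of_mem (fun v : Z => σ v) (Finset.mem_univ _) fun z _ hz => by
    rw [if_neg fun h => hz h.2.symm, zero_mul]]
  simp only [and_true, ite_mul, zero_mul,
    hf ((forall_mem_eq_extend_iff x (fun v : Z => σ v) σ).2 rfl)]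

theorem joint_comm (p : (V → A) → ℝ) (F Z : Finset V) (ρ τ : V → A) :
    joint p F Z ρ τ = joint p Z F τ ρ := by
  simp only [joint, and_comm]

theorem sum_joint (p : (V → A) → ℝ) (F Z : Finset V) (x : A) (τ : V → A) :
    ∑ w : F → A, joint p F Z (extend x w) τ = cyl p Z τ := by
  simpa [joint_comm p F] using
    sum_joint_mul p Z F x τ ((dependsOn_const (1 : ℝ)).mono (Set.empty_subset _))

theorem sum_cyl_mul (p : (V → A) → ℝ) (Z : Finset V) (x : A) {f : (V → A) → ℝ}
    (hf : DependsOn f Z) :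
    ∑ z : Z → A, cyl p Z (extend x z) * f (extend x z) = ∑ σ, p σ * f σ := by
  classical
  simpa [joint, cyl, mass] using sum_joint_mul p ∅ Z x (fun _ => x) hf

open Classical in
theorem cyl_eq_sum_cyl (p : (V → A) → ℝ) {Z Z' : Finset V} (hZ : Z' ⊆ Z) (x : A) (τ : V → A) :
    cyl p Z' τ = ∑ z : Z → A with ∀ v ∈ Z', extend x z v = τ v, cyl p Z (extend x z) := by
  have hdep : DependsOn (fun σ => if ∀ v ∈ Z', σ v = τ v then (1 : ℝ) else 0) Z :=
    fun σ σ' h => by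
      simp only [forall₂_congr fun v hv => show σ v = τ v ↔ σ' v = τ v by rw [h v (hZ hv)]]
  simpa [cyl, mass, Finset.sum_filter] using (sum_cyl_mul p Z x hdep).symm

theorem marginal_eq_cyl [DecidableEq A] (S : Finset V) (p : (V → A) → ℝ) (x : A) (w : S → A) :
    marginal S p w = cyl p S (extend x w) := by
  classical
  simp only [marginal, cyl, mass, forall_mem_eq_extend_iff]

theorem plugIn_eq_marginal [DecidableEq A] (r : V → ℕ) (S F : Finset V) {Z : Finset V} {X : V}
    (hX : X ∈ Z) (x : A) (p : (V → A) → ℝ) :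
    plugIn r S Z F X x p =
      marginal F fun σ => if σ X = x then p σ * density r S Z X p σ else 0 := by
  funext w
  have hdep : DependsOn (fun σ => if σ X = x then density r S Z X p σ else 0) Z :=
    fun σ σ' h => by simp only [h X hX, dependsOn_density r S Z X p h]
  have h := sum_joint_mul p F Z x (extend x w) hdep
  simp only [mul_ite, mul_zero] at h
  rw [plugIn, Finset.sum_filter, h, marginal_eq_cyl F _ x]

end Functional

/-! ### Identification -/

theorem card_mul_cyl_insert {V A : Type*} [Fintype V] [DecidableEq V] [Fintype A]
    {p : (V → A) → ℝ} {i : V} (hp : DependsOn p {i}ᶜ) {T : Finset V} (hi : i ∉ T) (τ : V → A) :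
    Fintype.card A * cyl p (insert i T) τ = cyl p T τ := by
  classical
  have hupdate : ∀ σ a, p (Function.update σ i a) = p σ := fun σ a =>
    hp fun v hv => Function.update_of_ne hv _ _
  have hagree : ∀ σ a, (∀ v ∈ insert i T, Function.update σ i a v = τ v) ↔
      a = τ i ∧ ∀ v ∈ T, σ v = τ v := fun σ a => by
    rw [Finset.forall_mem_insert, Function.update_self]
    refine and_congr_right fun _ => forall₂_congr fun v hv => ?_
    rw [Function.update_of_ne (ne_of_mem_of_not_mem hv hi)]
  simp only [cyl, mass, Finset.sum_filter]
  rw [← sum_sum_update i]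
  simp only [hagree, hupdate, ite_and, Finset.sum_ite_eq', Finset.mem_univ, if_true]

namespace CausalBayesNet

variable {V : Type u} [Fintype V] [DecidableEq V] {A : Type v} [Fintype A] {G : ADMG V}
  (M : CausalBayesNet.{u, v, w} G A) {r : V → ℕ} {S D : Finset V} {X i : V} {τ : V → A}

theorem cyl_obs_mul_pow [Nonempty A] (hD : G.IsAncestral D) {T : Finset V} (hT : T ⊆ D)
    (τ : V → A) :
    cyl M.obs T τ * (Fintype.card A : ℝ) ^ Dᶜ.card = cyl (M.partialLaw D) T τ := by
  classical
  have hdep : DependsOn (fun σ => if ∀ v ∈ T, σ v = τ v then (1 : ℝ) else 0) (↑Dᶜ : Set V)ᶜ :=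
    fun σ σ' h => by
      simp only [forall₂_congr fun v hv => show σ v = τ v ↔ σ' v = τ v by
        rw [h v (by simpa using hT hv)]]
  have hchild : ∀ i ∈ Dᶜ, ∀ v ∈ Finset.univ \ Dᶜ, ¬ G.directed i v := fun i hi v hv hiv =>
    Finset.mem_compl.1 hi (hD hiv (by simpa using hv))
  simpa [cyl, mass, Finset.sum_filter, obs_eq_partialLaw_univ] using
    M.sum_mul_partialLaw_mul_pow (Finset.subset_univ _) hchild hdep

/-- The part of the probability of the values of `G.paPlus S ∩ D` that the mechanisms outside `S`
contribute, for an ancestral set `D`. -/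
noncomputable def coFactor (S D : Finset V) (τ : V → A) : ℝ :=
  cyl (M.partialLaw (D \ S)) (G.paPlus S ∩ D) τ / (Fintype.card A : ℝ) ^ Dᶜ.card

theorem cyl_obs_eq_partialLaw_mul_coFactor [Nonempty A] (hS : G.IsCClosed S)
    (hD : G.IsAncestral D) (τ : V → A) :
    cyl M.obs (G.paPlus S ∩ D) τ = M.partialLaw (S ∩ D) τ * M.coFactor S D τ := by
  have hA : (Fintype.card A : ℝ) ≠ 0 := by exact_mod_cast Fintype.card_ne_zero
  have hsplit : M.partialLaw D = fun σ => M.partialLaw (S ∩ D) σ * M.partialLaw (D \ S) σ := by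
    funext σ
    rw [← M.partialLaw_union hS Finset.inter_subset_left Finset.sdiff_disjoint, Finset.inter_comm,
      Finset.union_comm, Finset.sdiff_union_inter]
  have hdep : DependsOn (M.partialLaw (S ∩ D)) (G.paPlus S ∩ D : Finset V) := by
    refine (M.dependsOn_partialLaw _).mono fun v hv => ?_
    rw [Finset.mem_coe, ADMG.mem_paPlus] at hv
    rw [Finset.mem_coe, Finset.mem_inter, ADMG.mem_paPlus]
    rcases hv with hv | ⟨w, hw, hvw⟩
    · exact ⟨.inl (Finset.mem_inter.1 hv).1, (Finset.mem_inter.1 hv).2⟩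
    · obtain ⟨hwS, hwD⟩ := Finset.mem_inter.1 hw
      exact ⟨.inr ⟨w, hwS, hvw⟩, hD hvw hwD⟩
  rw [coFactor, ← mul_div_assoc, eq_div_iff (pow_ne_zero _ hA),
    M.cyl_obs_mul_pow hD Finset.inter_subset_right, hsplit, cyl_mul_left hdep]

theorem coFactor_insert [Nonempty A] (hi : i ∈ S) (hiD : i ∉ D)
    (hchild : ∀ v ∈ D, ¬ G.directed i v) (τ : V → A) :
    M.coFactor S (insert i D) τ = M.coFactor S D τ := by
  have hA : (Fintype.card A : ℝ) ≠ 0 := by exact_mod_cast Fintype.card_ne_zero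
  have hdep : DependsOn (M.partialLaw (D \ S)) {i}ᶜ :=
    M.dependsOn_partialLaw_compl (by simp [hi]) fun v hv => hchild v (Finset.mem_sdiff.1 hv).1
  have hcard : Dᶜ.card = (insert i D)ᶜ.card + 1 := by
    rw [Finset.compl_insert, Finset.card_erase_add_one (Finset.mem_compl.2 hiD)]
  have hcyl := card_mul_cyl_insert hdep (T := G.paPlus S ∩ D) (by simp [hiD]) τ
  rw [coFactor, coFactor, Finset.insert_sdiff_of_mem _ hi,
    Finset.inter_insert_of_mem (ADMG.subset_paPlus S hi), hcard, pow_succ', ← hcyl,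
    mul_div_mul_left _ _ hA]

theorem partialLaw_insert_eq_mul [Nonempty A] (hS : G.IsCClosed S) (hi : i ∈ S) (hiD : i ∉ D)
    (hD : G.IsAncestral D) (hiD' : G.IsAncestral (insert i D))
    (hτ : cyl M.obs (G.paPlus S ∩ D) τ ≠ 0) :
    M.partialLaw (insert i (S ∩ D)) τ = M.partialLaw (S ∩ D) τ *
      (cyl M.obs (G.paPlus S ∩ insert i D) τ / cyl M.obs (G.paPlus S ∩ D) τ) := by
  have hchild : ∀ v ∈ D, ¬ G.directed i v := fun v hv hiv => hiD (hD hiv hv)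
  have hins := M.cyl_obs_eq_partialLaw_mul_coFactor hS hiD' τ
  rw [M.coFactor_insert hi hiD hchild, Finset.inter_insert_of_mem hi] at hins
  rw [M.cyl_obs_eq_partialLaw_mul_coFactor hS hD] at hτ ⊢
  rw [hins, mul_div_mul_right _ _ (right_ne_zero_of_mul hτ),
    mul_div_cancel₀ _ (left_ne_zero_of_mul hτ)]

theorem partialLaw_eq_chainProd [Nonempty A] (hr : G.IsTopologicalOrder r) (hS : G.IsCClosed S)
    (hτ : 0 < cyl M.obs (G.paPlus S) τ) :
    M.partialLaw S τ = chainProd r S (G.paPlus S) M.obs τ := by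
  have hstep : ∀ i ∈ S, M.partialLaw (insert i {v ∈ S | r v < r i}) τ =
      M.partialLaw {v ∈ S | r v < r i} τ * (cyl M.obs {u ∈ G.paPlus S | r u ≤ r i} τ /
        cyl M.obs {u ∈ G.paPlus S | r u < r i} τ) := by
    intro i hi
    have hlt : ∀ T : Finset V, {v ∈ T | r v < r i} = T ∩ Finset.univ.filter (r · < r i) :=
      fun T => by ext; simp
    have hle : ∀ T : Finset V, {v ∈ T | r v ≤ r i} = T ∩ Finset.univ.filter (r · ≤ r i) :=
      fun T => by ext; simp
    have hpos : 0 < cyl M.obs {v ∈ G.paPlus S | r v < r i} τ :=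
      hτ.trans_le (cyl_anti M.isDistribution_obs.1 (Finset.filter_subset _ _) τ)
    rw [hlt] at hpos
    rw [hlt S, hlt (G.paPlus S), hle,
      filter_le_eq_insert_filter_lt hr.injective (Finset.mem_univ i)]
    refine M.partialLaw_insert_eq_mul hS hi (by simp) (hr.isAncestral_filter_lt _) ?_ hpos.ne'
    rw [← filter_le_eq_insert_filter_lt hr.injective (Finset.mem_univ i)]
    exact hr.isAncestral_filter_le _
  have hprod := eq_mul_prod_of_insert_eq_mul hr.injective (fun T => M.partialLaw T τ)
    (fun i => cyl M.obs {u ∈ G.paPlus S | r u ≤ r i} τ / cyl M.obs {u ∈ G.paPlus S | r u < r i} τ)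
    S hstep
  rwa [partialLaw_empty, one_mul] at hprod

theorem partialLaw_ne_zero [Nonempty A] (hS : G.IsCClosed S)
    (hτ : cyl M.obs (G.paPlus S) τ ≠ 0) : M.partialLaw S τ ≠ 0 := by
  have h := M.cyl_obs_eq_partialLaw_mul_coFactor hS (D := .univ)
    (fun a _ _ _ => Finset.mem_univ a) τ
  simp only [Finset.inter_univ] at h
  exact left_ne_zero_of_mul (h ▸ hτ)

theorem partialLaw_univ_erase (hS : G.IsCClosed S) (hXS : X ∈ S)
    (hchild : ∀ c ∈ S, ¬ G.directed X c) (σ : V → A) :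
    M.partialLaw (Finset.univ.erase X) σ =
      (∑ a, M.partialLaw S (Function.update σ X a)) * M.partialLaw Sᶜ σ := by
  have hsplit : Finset.univ.erase X = S.erase X ∪ Sᶜ := by
    ext v
    by_cases hv : v = X
    · simp [hv, hXS]
    · simp [hv, em]
  have hsum := M.sum_partialLaw_insert (Finset.notMem_erase X S)
    (fun v hv => hchild v (Finset.mem_of_mem_erase hv)) σ
  rw [Finset.insert_erase hXS] at hsum
  rw [hsplit, M.partialLaw_union hS (Finset.erase_subset _ _) disjoint_compl_left, hsum]

theorem interv_eq [Nonempty A] [DecidableEq A] (hr : G.IsTopologicalOrder r) (hS : G.IsCClosed S)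
    (hXS : X ∈ S) (hchild : ∀ c ∈ S, ¬ G.directed X c)
    (hpos : ∀ τ, 0 < cyl M.obs (G.paPlus S) τ) (x : A) :
    M.interv X x = fun σ =>
      if σ X = x then M.obs σ * density r S (G.paPlus S) X M.obs σ else 0 := by
  funext σ
  refine if_congr Iff.rfl ?_ rfl
  change M.partialLaw _ σ = _
  have hne := M.partialLaw_ne_zero hS (hpos σ).ne'
  rw [M.partialLaw_univ_erase hS hXS hchild, M.obs_eq_partialLaw_mul_compl hS, density]
  simp_rw [← M.partialLaw_eq_chainProd hr hS (hpos _)]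
  field_simp

theorem plugIn_obs [Nonempty A] [DecidableEq A] (hr : G.IsTopologicalOrder r)
    (hS : G.IsCClosed S) (hXS : X ∈ S) (hchild : ∀ c ∈ S, ¬ G.directed X c)
    (hpos : ∀ τ, 0 < cyl M.obs (G.paPlus S) τ) (F : Finset V) (x : A) :
    plugIn r S (G.paPlus S) F X x M.obs = marginal F (M.interv X x) := by
  rw [plugIn_eq_marginal r S F (ADMG.subset_paPlus S hXS), M.interv_eq hr hS hXS hchild hpos]

end CausalBayesNet

/-! ### Stability of the plug-in functional -/

/-- Two positive real numbers that agree up to the factor `exp t`; the exponents add up under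
multiplication and division. -/
structure RelClose (t a b : ℝ) : Prop where
  left_pos : 0 < a
  right_pos : 0 < b
  left_le : a ≤ Real.exp t * b
  right_le : b ≤ Real.exp t * a

namespace RelClose

variable {t t' a b a' b' : ℝ}

theorem one : RelClose 0 1 1 := by
  constructor <;> simp

theorem mul (h : RelClose t a b) (h' : RelClose t' a' b') :
    RelClose (t + t') (a * a') (b * b') where
  left_pos := mul_pos h.left_pos h'.left_pos
  right_pos := mul_pos h.right_pos h'.right_pos
  left_le := by
    rw [Real.exp_add, mul_mul_mul_comm]
    exact mul_le_mul h.left_le h'.left_le h'.left_pos.le (h.left_pos.le.trans h.left_le)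
  right_le := by
    rw [Real.exp_add, mul_mul_mul_comm]
    exact mul_le_mul h.right_le h'.right_le h'.right_pos.le (h.right_pos.le.trans h.right_le)

theorem inv (h : RelClose t a b) : RelClose t a⁻¹ b⁻¹ where
  left_pos := inv_pos.2 h.left_pos
  right_pos := inv_pos.2 h.right_pos
  left_le := by
    rw [← div_eq_mul_inv, inv_eq_one_div, div_le_div_iff₀ h.left_pos h.right_pos, one_mul]
    exact h.right_le
  right_le := by
    rw [← div_eq_mul_inv, inv_eq_one_div, div_le_div_iff₀ h.right_pos h.left_pos, one_mul]
    exact h.left_le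

theorem div (h : RelClose t a b) (h' : RelClose t' a' b') :
    RelClose (t + t') (a / a') (b / b') := by
  rw [div_eq_mul_inv, div_eq_mul_inv]
  exact h.mul h'.inv

theorem prod {ι : Type*} {s : Finset ι} {f g : ι → ℝ} (h : ∀ i ∈ s, RelClose t (f i) (g i)) :
    RelClose (s.card * t) (∏ i ∈ s, f i) (∏ i ∈ s, g i) := by
  classical
  induction s using Finset.induction_on with
  | empty => simpa using one
  | insert i s hi ih =>
    rw [Finset.prod_insert hi, Finset.prod_insert hi, Finset.card_insert_of_notMem hi,
      Nat.cast_succ, add_one_mul, add_comm]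
    exact (h i (Finset.mem_insert_self i s)).mul
      (ih fun j hj => h j (Finset.mem_insert_of_mem hj))

theorem sum {ι : Type*} {s : Finset ι} (hs : s.Nonempty) {f g : ι → ℝ}
    (h : ∀ i ∈ s, RelClose t (f i) (g i)) : RelClose t (∑ i ∈ s, f i) (∑ i ∈ s, g i) where
  left_pos := Finset.sum_pos (fun i hi => (h i hi).left_pos) hs
  right_pos := Finset.sum_pos (fun i hi => (h i hi).right_pos) hs
  left_le := Finset.mul_sum s g _ ▸ Finset.sum_le_sum fun i hi => (h i hi).left_le
  right_le := Finset.mul_sum s f _ ▸ Finset.sum_le_sum fun i hi => (h i hi).right_le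

theorem of_abs_sub_le {η : ℝ} (hη : 0 ≤ η) (hη' : η ≤ 1 / 2) (hb : 0 < b)
    (h : |a - b| ≤ η * b) : RelClose (2 * η) a b := by
  obtain ⟨hlo, hup⟩ := abs_le.1 h
  have hexp := Real.add_one_le_exp (2 * η)
  have ha : 0 < a := by nlinarith
  -- `(1 - η) * (1 + 2 * η) ≥ 1` because `η ≤ 1 / 2`
  have hmul : b ≤ (1 - η) * b * (2 * η + 1) := by
    nlinarith [mul_nonneg (mul_nonneg hη hb.le) (sub_nonneg.2 hη')]
  refine ⟨ha, hb, ?_, ?_⟩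
  · nlinarith [mul_le_mul_of_nonneg_right hexp hb.le]
  · calc b ≤ (1 - η) * b * (2 * η + 1) := hmul
      _ ≤ a * Real.exp (2 * η) := mul_le_mul (by linarith) hexp (by linarith) ha.le
      _ = Real.exp (2 * η) * a := mul_comm _ _

theorem abs_sub_le (h : RelClose t a b) : |a - b| ≤ (Real.exp t - 1) * b := by
  have hlow : (2 - Real.exp t) * b ≤ a := by
    rcases le_or_gt (Real.exp t) 2 with ht | ht
    · nlinarith [mul_le_mul_of_nonneg_left h.right_le (sub_nonneg.2 ht),
        mul_nonneg h.left_pos.le (sq_nonneg (Real.exp t - 1))]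
    · nlinarith [h.left_pos, h.right_pos]
  rw [abs_le]
  constructor <;> linarith [h.left_le]

theorem abs_mul_sub_mul_le {c d κ : ℝ} (h : RelClose t a b) (hd : 0 ≤ d) (hcd : |c - d| ≤ κ) :
    |c * a - d * b| ≤ (Real.exp t * κ + (Real.exp t - 1) * d) * b :=
  calc |c * a - d * b| = |(c - d) * a + d * (a - b)| := by ring_nf
    _ ≤ |(c - d) * a| + |d * (a - b)| := abs_add_le _ _
    _ = |c - d| * a + d * |a - b| := by
      rw [abs_mul, abs_mul, abs_of_pos h.left_pos, abs_of_nonneg hd]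
    _ ≤ κ * (Real.exp t * b) + d * ((Real.exp t - 1) * b) :=
      add_le_add (mul_le_mul hcd h.left_le h.left_pos.le ((abs_nonneg _).trans hcd))
        (mul_le_mul_of_nonneg_left h.abs_sub_le hd)
    _ = (Real.exp t * κ + (Real.exp t - 1) * d) * b := by ring

end RelClose

section Normalization

variable {Ω : Type*} [Fintype Ω] {p g : Ω → ℝ}

theorem isDistribution_div_sum (hg : ∀ w, 0 ≤ g w) (hpos : 0 < ∑ w, g w) :
    IsDistribution fun w => g w / ∑ w', g w' :=
  ⟨fun w => div_nonneg (hg w) hpos.le, by rw [← Finset.sum_div, div_self hpos.ne']⟩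

theorem IsDistribution.abs_one_sub_sum_le (hp : IsDistribution p) (g : Ω → ℝ) :
    |1 - ∑ w, g w| ≤ ∑ w, |p w - g w| := by
  rw [← hp.2, ← Finset.sum_sub_distrib]
  exact Finset.abs_sum_le_sum_abs _ _

theorem IsDistribution.tvDist_div_sum_le (hp : IsDistribution p) (hg : ∀ w, 0 ≤ g w)
    (hpos : 0 < ∑ w, g w) : tvDist p (fun w => g w / ∑ w', g w') ≤ ∑ w, |p w - g w| := by
  have hterm : ∀ w, |g w - g w / ∑ w', g w'| = g w * (|1 - ∑ w', g w'| / ∑ w', g w') := fun w => by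
    rw [show g w - g w / ∑ w', g w' = g w * -((1 - ∑ w', g w') / ∑ w', g w') by field_simp; ring,
      abs_mul, abs_neg, abs_div, abs_of_nonneg (hg w), abs_of_pos hpos]
  have hnormalize : ∑ w, |g w - g w / ∑ w', g w'| = |1 - ∑ w, g w| := by
    rw [Finset.sum_congr rfl fun w _ => hterm w, ← Finset.sum_mul, mul_div_cancel₀ _ hpos.ne']
  have htriangle : ∑ w, |p w - g w / ∑ w', g w'| ≤
      ∑ w, |p w - g w| + ∑ w, |g w - g w / ∑ w', g w'| :=
    Finset.sum_add_distrib (M := ℝ) ▸ Finset.sum_le_sum fun w _ => _root_.abs_sub_le _ _ _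
  rw [tvDist]
  linarith [hp.abs_one_sub_sum_le g]

end Normalization

section Estimator

variable {V : Type*} [Fintype V] [DecidableEq V] {A : Type*} [Fintype A]
  {p q : (V → A) → ℝ} {F Z S : Finset V} {X : V} {x : A} {r : V → ℕ} {η : ℝ}

theorem abs_cyl_sub_le
    (h : ∀ (w : F → A) (z : Z → A),
      |joint q F Z (extend x w) (extend x z) - joint p F Z (extend x w) (extend x z)| ≤
        η / (Fintype.card A : ℝ) ^ F.card * cyl p Z (extend x z))
    {Z' : Finset V} (hZ : Z' ⊆ Z) (τ : V → A) : |cyl q Z' τ - cyl p Z' τ| ≤ η * cyl p Z' τ := by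
  have : Nonempty A := ⟨x⟩
  have hcard : (Fintype.card A : ℝ) ^ F.card ≠ 0 :=
    pow_ne_zero _ (Nat.cast_ne_zero.2 Fintype.card_ne_zero)
  have hcyl : ∀ z : Z → A, |cyl q Z (extend x z) - cyl p Z (extend x z)| ≤
      η * cyl p Z (extend x z) := fun z => by
    rw [← sum_joint q F Z x, ← sum_joint p F Z x (extend x z), ← Finset.sum_sub_distrib]
    refine (Finset.abs_sum_le_sum_abs _ _).trans ((Finset.sum_le_sum fun w _ => h w z).trans ?_)
    rw [sum_joint, Finset.sum_const, Finset.card_univ, Fintype.card_fun, Fintype.card_coe,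
      nsmul_eq_mul, Nat.cast_pow, ← mul_assoc, mul_div_cancel₀ _ hcard]
  rw [cyl_eq_sum_cyl q hZ x, cyl_eq_sum_cyl p hZ x τ, ← Finset.sum_sub_distrib, Finset.mul_sum]
  exact (Finset.abs_sum_le_sum_abs _ _).trans (Finset.sum_le_sum fun z _ => hcyl z)

theorem relClose_density (hη : 0 ≤ η) (hη' : η ≤ 1 / 2) (hp : ∀ σ, 0 ≤ p σ)
    (hpos : ∀ τ, 0 < cyl p Z τ)
    (h : ∀ Z' ⊆ Z, ∀ τ, |cyl q Z' τ - cyl p Z' τ| ≤ η * cyl p Z' τ) (τ : V → A) :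
    RelClose (8 * S.card * η) (density r S Z X q τ) (density r S Z X p τ) := by
  have hcyl : ∀ Z' ⊆ Z, ∀ τ, RelClose (2 * η) (cyl q Z' τ) (cyl p Z' τ) := fun Z' hZ' τ =>
    .of_abs_sub_le hη hη' ((hpos τ).trans_le (cyl_anti hp hZ' τ)) (h Z' hZ' τ)
  have hchain : ∀ τ, RelClose (S.card * (2 * η + 2 * η)) (chainProd r S Z q τ)
      (chainProd r S Z p τ) := fun τ =>
    .prod fun v _ => (hcyl _ (Finset.filter_subset _ Z) τ).div
      (hcyl _ (Finset.filter_subset _ Z) τ)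
  rw [show 8 * (S.card : ℝ) * η = S.card * (2 * η + 2 * η) + S.card * (2 * η + 2 * η) by ring]
  exact (RelClose.sum ⟨τ X, Finset.mem_univ _⟩ fun a _ => hchain (Function.update τ X a)).div
    (hchain τ)

variable [DecidableEq A]

theorem plugIn_nonneg (hq : ∀ σ, 0 ≤ q σ) (w : F → A) : 0 ≤ plugIn r S Z F X x q w := by
  have hchain : ∀ τ, 0 ≤ chainProd r S Z q τ := fun τ =>
    Finset.prod_nonneg fun v _ => div_nonneg (cyl_nonneg hq _ _) (cyl_nonneg hq _ _)
  exact Finset.sum_nonneg fun z _ => mul_nonneg (mass_nonneg hq _)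
    (div_nonneg (Finset.sum_nonneg fun a _ => hchain _) (hchain _))

theorem sum_plugIn (r : V → ℕ) (S Z F : Finset V) (X : V) (x : A) (p : (V → A) → ℝ) :
    ∑ w, plugIn r S Z F X x p w =
      ∑ z : Z → A with extend x z X = x, cyl p Z (extend x z) * density r S Z X p (extend x z) := by
  simp only [plugIn]
  rw [Finset.sum_comm]
  simp only [← Finset.sum_mul, sum_joint]

theorem abs_plugIn_sub_le (hη : 0 ≤ η) (hη' : η ≤ 1 / 2) (hp : ∀ σ, 0 ≤ p σ)
    (hpos : ∀ τ, 0 < cyl p Z τ)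
    (h : ∀ (w : F → A) (z : Z → A),
      |joint q F Z (extend x w) (extend x z) - joint p F Z (extend x w) (extend x z)| ≤
        η / (Fintype.card A : ℝ) ^ F.card * cyl p Z (extend x z)) (w : F → A) :
    |plugIn r S Z F X x q w - plugIn r S Z F X x p w| ≤
      Real.exp (8 * S.card * η) * (η / (Fintype.card A : ℝ) ^ F.card) *
          ∑ w', plugIn r S Z F X x p w' +
        (Real.exp (8 * S.card * η) - 1) * plugIn r S Z F X x p w := by
  rw [sum_plugIn]
  simp only [plugIn]
  rw [← Finset.sum_sub_distrib, Finset.mul_sum, Finset.mul_sum, ← Finset.sum_add_distrib]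
  refine (Finset.abs_sum_le_sum_abs _ _).trans (Finset.sum_le_sum fun z _ => ?_)
  have hdensity := relClose_density (r := r) (S := S) (X := X) hη hη' hp hpos
    (fun _ hZ => abs_cyl_sub_le h hZ) (extend x z)
  refine (hdensity.abs_mul_sub_mul_le (mass_nonneg hp _) (h w z)).trans_eq ?_
  rw [joint]
  ring

theorem sum_abs_plugIn_sub_le (hη : 0 ≤ η) (hη' : η ≤ 1 / 2) (hp : ∀ σ, 0 ≤ p σ)
    (hpos : ∀ τ, 0 < cyl p Z τ)
    (h : ∀ (w : F → A) (z : Z → A),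
      |joint q F Z (extend x w) (extend x z) - joint p F Z (extend x w) (extend x z)| ≤
        η / (Fintype.card A : ℝ) ^ F.card * cyl p Z (extend x z)) :
    ∑ w, |plugIn r S Z F X x q w - plugIn r S Z F X x p w| ≤
      (Real.exp (8 * S.card * η) * (1 + η) - 1) * ∑ w, plugIn r S Z F X x p w := by
  have : Nonempty A := ⟨x⟩
  have hcard : (Fintype.card A : ℝ) ^ F.card ≠ 0 :=
    pow_ne_zero _ (Nat.cast_ne_zero.2 Fintype.card_ne_zero)
  refine (Finset.sum_le_sum fun w _ => abs_plugIn_sub_le hη hη' hp hpos h w).trans_eq ?_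
  rw [Finset.sum_add_distrib, ← Finset.mul_sum _ _ (Real.exp _ - 1), Finset.sum_const,
    Finset.card_univ, Fintype.card_fun, Fintype.card_coe, nsmul_eq_mul, Nat.cast_pow]
  field_simp
  ring

end Estimator

/-! ### Programs for the plug-in functional -/

namespace RAM

theorem code_injective {A : Type*} [Fintype A] : Function.Injective (code : A → ℕ) := fun _ _ h =>
  (Fintype.equivFin A).injective (Fin.val_injective h)

section Expressions

open ArithExpr

variable {V A : Type*} [Fintype A]

/-- The expression with value `1` if the symbols with index `i` agree with `τ` on `T`, and `0`
otherwise. -/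
noncomputable def agreeExpr (i : ℕ) (T : Finset V) (τ : V → A) : ArithExpr V :=
  prod T fun v => eqSymbol i v (code (τ v))

/-- The expression for `cyl` of the empirical distribution of `m` samples. -/
noncomputable def cylExpr (m : ℕ) (T : Finset V) (τ : V → A) : ArithExpr V :=
  op .div (sum .univ fun j : Fin m => agreeExpr j T τ) (const m)

/-- The expression for `joint` of the empirical distribution of `m` samples. -/
noncomputable def jointExpr (m : ℕ) (F Z : Finset V) (ρ τ : V → A) : ArithExpr V :=
  op .div (sum .univ fun j : Fin m => op .mul (agreeExpr j F ρ) (agreeExpr j Z τ)) (const m)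

/-- The expression for `chainProd` of the empirical distribution of `m` samples. -/
noncomputable def chainProdExpr (m : ℕ) (r : V → ℕ) (S Z : Finset V) (τ : V → A) : ArithExpr V :=
  prod S fun v => op .div (cylExpr m {u ∈ Z | r u ≤ r v} τ) (cylExpr m {u ∈ Z | r u < r v} τ)

/-- The expression for `density` of the empirical distribution of `m` samples. -/
noncomputable def densityExpr [DecidableEq V] (m : ℕ) (r : V → ℕ) (S Z : Finset V) (X : V)
    (τ : V → A) : ArithExpr V :=
  op .div (sum .univ fun a => chainProdExpr m r S Z (Function.update τ X a))
    (chainProdExpr m r S Z τ)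

/-- The expression for `plugIn` of the empirical distribution of `m` samples. -/
noncomputable def plugInExpr [DecidableEq V] [DecidableEq A] (m : ℕ) (r : V → ℕ)
    (S Z F : Finset V) (X : V) (x : A) (w : F → A) : ArithExpr V :=
  sum {z : Z → A | extend x z X = x} fun z =>
    op .mul (jointExpr m F Z (extend x w) (extend x z)) (densityExpr m r S Z X (extend x z))

section Cells

theorem cellsBelow_agreeExpr (i : ℕ) (T : Finset V) (τ : V → A) (n : ℕ) :
    (agreeExpr i T τ).CellsBelow n :=
  cellsBelow_fold _ _ fun _ _ => ⟨trivial, ⟨trivial, trivial⟩, trivial, trivial⟩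

theorem cellsBelow_cylExpr (m : ℕ) (T : Finset V) (τ : V → A) (n : ℕ) :
    (cylExpr m T τ).CellsBelow n :=
  ⟨cellsBelow_fold _ _ fun _ _ => cellsBelow_agreeExpr _ _ _ _, trivial⟩

theorem cellsBelow_jointExpr (m : ℕ) (F Z : Finset V) (ρ τ : V → A) (n : ℕ) :
    (jointExpr m F Z ρ τ).CellsBelow n :=
  ⟨cellsBelow_fold _ _ fun _ _ => ⟨cellsBelow_agreeExpr _ _ _ _, cellsBelow_agreeExpr _ _ _ _⟩,
    trivial⟩

theorem cellsBelow_chainProdExpr (m : ℕ) (r : V → ℕ) (S Z : Finset V) (τ : V → A) (n : ℕ) :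
    (chainProdExpr m r S Z τ).CellsBelow n :=
  cellsBelow_fold _ _ fun _ _ => ⟨cellsBelow_cylExpr _ _ _ _, cellsBelow_cylExpr _ _ _ _⟩

theorem cellsBelow_plugInExpr [DecidableEq V] [DecidableEq A] (m : ℕ) (r : V → ℕ)
    (S Z F : Finset V) (X : V) (x : A) (w : F → A) (n : ℕ) :
    (plugInExpr m r S Z F X x w).CellsBelow n :=
  cellsBelow_fold _ _ fun _ _ => ⟨cellsBelow_jointExpr _ _ _ _ _ _,
    cellsBelow_fold _ _ fun _ _ => cellsBelow_chainProdExpr _ _ _ _ _ _,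
    cellsBelow_chainProdExpr _ _ _ _ _ _⟩

end Cells

section Values

theorem eval_agreeExpr (inp : ℕ → V → ℕ) (mem : ℕ → ℚ) (i : ℕ) (T : Finset V) (τ : V → A) :
    (agreeExpr i T τ).eval inp mem = if ∀ v ∈ T, inp i v = code (τ v) then 1 else 0 := by
  simp only [agreeExpr, eval_prod, eval_eqSymbol, Finset.prod_ite_zero, Finset.prod_const_one]

variable {m : ℕ} (s : Fin m → V → A) (mem : ℕ → ℚ)

theorem eval_agreeExpr_sampleInput [DecidableEq A] (j : Fin m) (T : Finset V) (τ : V → A) :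
    (agreeExpr (j : ℕ) T τ).eval (sampleInput s) mem = if ∀ v ∈ T, s j v = τ v then 1 else 0 := by
  simp only [eval_agreeExpr, sampleInput, j.2, dite_true, Fin.eta, code_injective.eq_iff]

variable [Fintype V] [DecidableEq V]

theorem eval_cylExpr (T : Finset V) (τ : V → A) :
    ((cylExpr m T τ).eval (sampleInput s) mem : ℝ) = cyl (empirical s) T τ := by
  classical
  simp only [cyl, mass_empirical, cylExpr, eval, ArithOp.eval, eval_sum,
    eval_agreeExpr_sampleInput, Finset.natCast_card_filter]
  push_cast
  congr! 2
  split_ifs <;> simp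

theorem eval_jointExpr (F Z : Finset V) (ρ τ : V → A) :
    ((jointExpr m F Z ρ τ).eval (sampleInput s) mem : ℝ) = joint (empirical s) F Z ρ τ := by
  classical
  simp only [joint, mass_empirical, jointExpr, eval, ArithOp.eval, eval_sum,
    eval_agreeExpr_sampleInput, ite_zero_mul_ite_zero, mul_one, Finset.natCast_card_filter]
  push_cast
  congr! 2
  split_ifs <;> simp

theorem eval_chainProdExpr (r : V → ℕ) (S Z : Finset V) (τ : V → A) :
    ((chainProdExpr m r S Z τ).eval (sampleInput s) mem : ℝ) =
      chainProd r S Z (empirical s) τ := by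
  simp only [chainProdExpr, chainProd, eval_prod, eval, ArithOp.eval, Rat.cast_prod, Rat.cast_div,
    eval_cylExpr]

theorem eval_densityExpr (r : V → ℕ) (S Z : Finset V) (X : V) (τ : V → A) :
    ((densityExpr m r S Z X τ).eval (sampleInput s) mem : ℝ) =
      density r S Z X (empirical s) τ := by
  simp only [densityExpr, density, eval_sum, eval, ArithOp.eval, Rat.cast_sum, Rat.cast_div,
    eval_chainProdExpr]

theorem eval_plugInExpr [DecidableEq A] (r : V → ℕ) (S Z F : Finset V) (X : V) (x : A) (w : F → A) :
    ((plugInExpr m r S Z F X x w).eval (sampleInput s) mem : ℝ) =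
      plugIn r S Z F X x (empirical s) w := by
  simp only [plugInExpr, plugIn, eval_sum, eval, ArithOp.eval, Rat.cast_sum, Rat.cast_mul,
    eval_jointExpr, eval_densityExpr]

end Values

section Costs

theorem cost_agreeExpr_le (i : ℕ) (T : Finset V) (τ : V → A) :
    (agreeExpr i T τ).cost ≤ 12 * T.card + 1 :=
  (cost_fold_le _ _ _ (n := 11) fun _ _ => le_rfl).trans_eq (by ring)

variable {m N : ℕ}

theorem cost_cylExpr_le (hm : 1 ≤ m) (hN : 1 ≤ N) {T : Finset V} (hT : T.card ≤ N) (τ : V → A) :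
    (cylExpr m T τ).cost ≤ 17 * (m * N) := by
  have hsum : (sum .univ fun j : Fin m => agreeExpr j T τ).cost ≤ m * (12 * N + 1 + 1) + 1 := by
    simpa using cost_fold_le .add 0 (Finset.univ : Finset (Fin m)) fun j _ =>
      (cost_agreeExpr_le j T τ).trans (show _ ≤ 12 * N + 1 by omega)
  rw [cylExpr, cost, cost]
  nlinarith [Nat.mul_le_mul hm hN, Nat.mul_le_mul_left m hN]

theorem cost_jointExpr_le (hm : 1 ≤ m) (hN : 1 ≤ N) {F Z : Finset V} (hFZ : F.card + Z.card ≤ N)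
    (ρ τ : V → A) : (jointExpr m F Z ρ τ).cost ≤ 19 * (m * N) := by
  have hterm : ∀ j, (op .mul (agreeExpr j F ρ) (agreeExpr j Z τ)).cost ≤ 12 * N + 3 := fun j => by
    have hF := cost_agreeExpr_le j F ρ
    have hZ := cost_agreeExpr_le j Z τ
    rw [cost]
    omega
  have hsum : (sum .univ fun j : Fin m => op .mul (agreeExpr j F ρ) (agreeExpr j Z τ)).cost ≤
      m * (12 * N + 3 + 1) + 1 := by
    simpa using cost_fold_le .add 0 (Finset.univ : Finset (Fin m)) fun j _ => hterm j
  rw [jointExpr, cost, cost]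
  nlinarith [Nat.mul_le_mul hm hN, Nat.mul_le_mul_left m hN]

variable {S Z : Finset V}

theorem cost_chainProdExpr_le (hm : 1 ≤ m) (hN : 1 ≤ N) (hZ : Z.card ≤ N) (hS : 1 ≤ S.card)
    (r : V → ℕ) (τ : V → A) : (chainProdExpr m r S Z τ).cost ≤ 37 * (S.card * (m * N)) := by
  have hprod := cost_fold_le .mul 1 S fun v _ =>
    show (op .div (cylExpr m {u ∈ Z | r u ≤ r v} τ) (cylExpr m {u ∈ Z | r u < r v} τ)).cost ≤
        34 * (m * N) + 1 by
      have hle := cost_cylExpr_le hm hN ((Z.card_filter_le fun u => r u ≤ r v).trans hZ) τ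
      have hlt := cost_cylExpr_le hm hN ((Z.card_filter_le fun u => r u < r v).trans hZ) τ
      rw [cost]
      omega
  have hmN := Nat.mul_le_mul hm hN
  rw [chainProdExpr]
  nlinarith [Nat.mul_le_mul_left S.card hmN, Nat.mul_le_mul hS hmN]

variable [DecidableEq V]

theorem cost_densityExpr_le (hm : 1 ≤ m) (hN : 1 ≤ N) (hZ : Z.card ≤ N) (hS : 1 ≤ S.card)
    (r : V → ℕ) (X : V) (τ : V → A) :
    (densityExpr m r S Z X τ).cost ≤ 77 * (Fintype.card A * (S.card * (m * N))) := by
  have hA : 1 ≤ Fintype.card A := Fintype.card_pos_iff.2 ⟨τ X⟩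
  have hsum := cost_fold_le .add 0 (Finset.univ : Finset A) fun a _ =>
    cost_chainProdExpr_le hm hN hZ hS r (Function.update τ X a)
  have hchain := cost_chainProdExpr_le hm hN hZ hS r τ
  have hQ := Nat.mul_le_mul hS (Nat.mul_le_mul hm hN)
  rw [Finset.card_univ] at hsum
  rw [densityExpr, cost]
  nlinarith [Nat.mul_le_mul_left (Fintype.card A) hQ, Nat.mul_le_mul_right (S.card * (m * N)) hA]

theorem cost_plugInExpr_le [DecidableEq A] {F : Finset V} (hm : 1 ≤ m) (hN : 1 ≤ N)
    (hFZ : F.card + Z.card ≤ N) (hS : 1 ≤ S.card) (r : V → ℕ) (X : V) (x : A) (w : F → A) :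
    (plugInExpr m r S Z F X x w).cost ≤
      99 * (Fintype.card A ^ (Z.card + 1) * (S.card * (m * N))) := by
  have hA : 1 ≤ Fintype.card A := Fintype.card_pos_iff.2 ⟨x⟩
  have hAZ : 1 ≤ Fintype.card A ^ Z.card := Nat.one_le_pow _ _ hA
  have hQ := Nat.mul_le_mul hA (Nat.mul_le_mul hS (Nat.mul_le_mul hm hN))
  have hterm : ∀ z : Z → A, (op .mul (jointExpr m F Z (extend x w) (extend x z))
      (densityExpr m r S Z X (extend x z))).cost ≤
        97 * (Fintype.card A * (S.card * (m * N))) := fun z => by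
    have hjoint := cost_jointExpr_le hm hN hFZ (extend x w) (extend x z)
    have hdensity := cost_densityExpr_le hm hN (by omega : Z.card ≤ N) hS r X (extend x z)
    have hmN : m * N ≤ Fintype.card A * (S.card * (m * N)) :=
      (Nat.le_mul_of_pos_left _ hS).trans (Nat.le_mul_of_pos_left _ hA)
    rw [cost]
    omega
  have hcard : ({z : Z → A | extend x z X = x} : Finset _).card ≤ Fintype.card A ^ Z.card :=
    (Finset.card_filter_le _ _).trans_eq (by simp)
  refine (cost_fold_le _ _ _ fun z _ => hterm z).trans ?_
  rw [pow_succ, mul_assoc]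
  nlinarith [Nat.mul_le_mul_right (97 * (Fintype.card A * (S.card * (m * N))) + 1) hcard,
    Nat.mul_le_mul_left (Fintype.card A ^ Z.card) hQ]

end Costs

end Expressions

variable {V : Type*} [DecidableEq V] {A : Type*} [Fintype A]

theorem forall_queryInput_eq_code_iff {F : Finset V} (x : A) (w w' : F → A) (i : ℕ) :
    (∀ v ∈ F, queryInput w i v = code (extend x w' v)) ↔ w = w' := by
  have hw : (fun v : F => extend x w v) = w :=
    (forall_mem_eq_extend_iff x w _).1 fun _ _ => rfl
  have hquery : ∀ v ∈ F, queryInput w i v = code (extend x w v) := fun v hv => by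
    rw [queryInput, dif_pos hv, ← congrFun hw ⟨v, hv⟩]
  rw [forall₂_congr fun v hv => by rw [hquery v hv, code_injective.eq_iff],
    forall_mem_eq_extend_iff, hw]

/-- The expression that looks up the value for the queried assignment in a table that stores the
value for `w` in the cell `1 + code w`, and divides it by the sum of the table. -/
noncomputable def lookup (x : A) (F : Finset V) : ArithExpr V :=
  .op .div
    (.sum .univ fun w : F → A => .op .mul (agreeExpr 0 F (extend x w)) (.cell (1 + code w)))
    (.sum .univ fun w : F → A => .cell (1 + code w))

/-- The evaluation program: it computes `lookup` above the table and moves the result to the output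
cell `0`. -/
noncomputable def evaluator (x : A) (F : Finset V) : List (Instr V) :=
  (lookup x F).compile (Fintype.card (F → A) + 1) ++
    [.const 0 0, .add 0 0 (Fintype.card (F → A) + 1)]

theorem eval_lookup (x : A) {F : Finset V} (w : F → A) {mem : ℕ → ℚ} {g : (F → A) → ℝ}
    (hmem : ∀ w, (mem (1 + code w) : ℝ) = g w) :
    ((lookup x F).eval (queryInput w) mem : ℝ) = g w / ∑ w', g w' := by
  classical
  simp only [lookup, ArithExpr.eval, ArithOp.eval, ArithExpr.eval_sum, eval_agreeExpr,
    forall_queryInput_eq_code_iff, ite_mul, one_mul, zero_mul, Finset.sum_ite_eq, Finset.mem_univ,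
    if_true, Rat.cast_div, Rat.cast_sum, hmem]

theorem cellsBelow_lookup (x : A) (F : Finset V) :
    (lookup x F).CellsBelow (Fintype.card (F → A) + 1) := by
  have hcell : ∀ w : F → A, 1 + code w < Fintype.card (F → A) + 1 := fun w => by
    rw [add_comm, Nat.add_lt_add_iff_right]
    exact Fin.is_lt _
  exact ⟨ArithExpr.cellsBelow_fold _ _ fun w _ => ⟨cellsBelow_agreeExpr _ _ _ _, hcell w⟩,
    ArithExpr.cellsBelow_fold _ _ fun w _ => hcell w⟩

theorem cost_lookup_le (x : A) (F : Finset V) :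
    (lookup x F).cost ≤ 20 * (Fintype.card A ^ F.card * (F.card + 1)) := by
  have hpos : 1 ≤ Fintype.card A ^ F.card := Nat.one_le_pow _ _ (Fintype.card_pos_iff.2 ⟨x⟩)
  have hcard : (Finset.univ : Finset (F → A)).card = Fintype.card A ^ F.card := by simp
  have hselect := ArithExpr.cost_fold_le .add 0 (Finset.univ : Finset (F → A)) fun w _ =>
    show (ArithExpr.op .mul (agreeExpr 0 F (extend x w)) (.cell (1 + code w))).cost ≤
        12 * F.card + 4 from
      Nat.add_le_add_right (Nat.add_le_add_right (cost_agreeExpr_le 0 F _) 2) 1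
  have htotal := ArithExpr.cost_fold_le .add 0 (Finset.univ : Finset (F → A)) fun w _ =>
    show (ArithExpr.cell (1 + code w) : ArithExpr V).cost ≤ 2 from le_rfl
  rw [hcard] at hselect htotal
  rw [lookup, ArithExpr.cost]
  nlinarith [Nat.zero_le (Fintype.card A ^ F.card * F.card)]

theorem length_evaluator_le (x : A) (F : Finset V) :
    (evaluator x F).length ≤ 22 * (Fintype.card A ^ F.card * (F.card + 1)) := by
  have hpos : 1 ≤ Fintype.card A ^ F.card := Nat.one_le_pow _ _ (Fintype.card_pos_iff.2 ⟨x⟩)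
  have hlookup := cost_lookup_le x F
  rw [evaluator, List.length_append, ArithExpr.length_compile, List.length_cons,
    List.length_singleton]
  nlinarith [Nat.zero_le (Fintype.card A ^ F.card * F.card)]

theorem run_evaluator_zero (x : A) {F : Finset V} (inp : ℕ → V → ℕ) (mem : ℕ → ℚ) :
    run inp (evaluator x F) mem 0 = (lookup x F).eval inp mem := by
  rw [← ArithExpr.run_compile_self inp (cellsBelow_lookup x F) mem, evaluator, run_append]
  simp [run, exec]

theorem isEvaluator_evaluator (x : A) {F : Finset V} {mem : ℕ → ℚ} {g : (F → A) → ℝ}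
    (hmem : ∀ w, (mem (1 + code w) : ℝ) = g w) {T : ℝ} (hT : ((evaluator x F).length : ℝ) ≤ T) :
    IsEvaluator (evaluator x F) mem T fun w => g w / ∑ w', g w' := by
  intro w
  have hjump : JumpFree (evaluator x F) :=
    (ArithExpr.jumpFree_compile _ _).append (by simp [JumpFree])
  refine ⟨_, hjump.haltsWithin _ mem hT, ?_⟩
  rw [run_evaluator_zero, eval_lookup x w hmem]

variable [DecidableEq A]

/-- The learning program: it stores the value of the plug-in functional of the empirical
distribution at `w` in the cell `1 + code w`. -/
noncomputable def learner (m : ℕ) (r : V → ℕ) (S Z F : Finset V) (X : V) (x : A) :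
    List (Instr V) :=
  ArithExpr.compileList
    (List.ofFn fun i => plugInExpr m r S Z F X x ((Fintype.equivFin (F → A)).symm i)) 1

variable {m : ℕ}

theorem jumpFree_learner (m : ℕ) (r : V → ℕ) (S Z F : Finset V) (X : V) (x : A) :
    JumpFree (learner m r S Z F X x) :=
  ArithExpr.jumpFree_compileList _ _

theorem length_learner_le {N : ℕ} {S Z F : Finset V} (hm : 1 ≤ m) (hN : 1 ≤ N)
    (hFZ : F.card + Z.card ≤ N) (hS : 1 ≤ S.card) (r : V → ℕ) (X : V) (x : A) :
    (learner m r S Z F X x).length ≤ 99 * (Fintype.card A ^ (N + 1) * (S.card * (m * N))) := by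
  have hlen := ArithExpr.length_compileList_le
    (l := List.ofFn fun i => plugInExpr m r S Z F X x ((Fintype.equivFin (F → A)).symm i))
    (List.forall_mem_ofFn_iff.2 fun i => cost_plugInExpr_le hm hN hFZ hS r X x _) 1
  refine hlen.trans ?_
  rw [List.length_ofFn, Fintype.card_fun, Fintype.card_coe, mul_left_comm, ← mul_assoc (_ ^ _),
    ← pow_add]
  have hpow : Fintype.card A ^ (F.card + (Z.card + 1)) ≤ Fintype.card A ^ (N + 1) :=
    Nat.pow_le_pow_right (Fintype.card_pos_iff.2 ⟨x⟩) (by omega)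
  gcongr

theorem run_learner [Fintype V] (r : V → ℕ) (S Z F : Finset V) (X : V) (x : A)
    (s : Fin m → V → A) (w : F → A) :
    (run (sampleInput s) (learner m r S Z F X x) (fun _ => 0) (1 + code w) : ℝ) =
      plugIn r S Z F X x (empirical s) w := by
  rw [learner, ArithExpr.run_compileList_add (sampleInput s)
    (List.forall_mem_ofFn_iff.2 fun i => cellsBelow_plugInExpr _ _ _ _ _ _ _ _ _) _
    (by rw [List.length_ofFn]; exact Fin.is_lt _), List.getElem_ofFn, eval_plugInExpr]
  simp only [code, Fin.eta, Equiv.symm_apply_apply]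

end RAM

/-! ### Accuracy of the normalised plug-in functional -/

theorem isDistribution_marginal {V A : Type*} [Fintype V] [DecidableEq V] [Fintype A]
    [DecidableEq A] {p : (V → A) → ℝ} (hp : IsDistribution p) (S : Finset V) :
    IsDistribution (marginal S p) :=
  ⟨fun _ => Finset.sum_nonneg fun σ _ => hp.1 σ, (Finset.sum_fiberwise _ _ _).trans hp.2⟩

namespace CausalBayesNet

variable {V : Type*} [Fintype V] [DecidableEq V] {G : ADMG V} {A : Type*} [Fintype A]
  [DecidableEq A] [Nonempty A] (M : CausalBayesNet G A) {r : V → ℕ} {S : Finset V} {X : V}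
  {ε η : ℝ}

theorem tvDist_plugIn_div_sum_le (hr : G.IsTopologicalOrder r) (hS : G.IsCClosed S) (hXS : X ∈ S)
    (hchild : ∀ c ∈ S, ¬ G.directed X c) (hpos : ∀ τ, 0 < cyl M.obs (G.paPlus S) τ)
    (F : Finset V) (x : A) {q : (V → A) → ℝ} (hq : ∀ σ, 0 ≤ q σ) (hη₀ : 0 ≤ η) (hη : η ≤ 1 / 2)
    (hηε : Real.exp (8 * S.card * η) * (1 + η) - 1 ≤ ε) (hε : ε < 1)
    (hjoint : ∀ (w : F → A) (z : G.paPlus S → A),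
      |joint q F (G.paPlus S) (extend x w) (extend x z) -
        joint M.obs F (G.paPlus S) (extend x w) (extend x z)| ≤
      η / Fintype.card A ^ F.card * cyl M.obs (G.paPlus S) (extend x z)) :
    (IsDistribution fun w => plugIn r S (G.paPlus S) F X x q w /
      ∑ w', plugIn r S (G.paPlus S) F X x q w') ∧
    tvDist (marginal F (M.interv X x)) (fun w => plugIn r S (G.paPlus S) F X x q w /
      ∑ w', plugIn r S (G.paPlus S) F X x q w') ≤ ε := by
  have hdist := isDistribution_marginal (M.isDistribution_interv X x) F
  have hnonneg := plugIn_nonneg (r := r) (S := S) (Z := G.paPlus S) (F := F) (X := X) (x := x) hq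
  have herr : ∑ w, |marginal F (M.interv X x) w - plugIn r S (G.paPlus S) F X x q w| ≤ ε := by
    have h := sum_abs_plugIn_sub_le (r := r) (S := S) (X := X) hη₀ hη M.isDistribution_obs.1 hpos
      hjoint
    rw [M.plugIn_obs hr hS hXS hchild hpos, hdist.2, mul_one] at h
    simpa only [abs_sub_comm] using h.trans hηε
  have hsum : 0 < ∑ w, plugIn r S (G.paPlus S) F X x q w := by
    linarith [(abs_le.1 ((hdist.abs_one_sub_sum_le _).trans herr)).2]
  exact ⟨isDistribution_div_sum hnonneg hsum, (hdist.tvDist_div_sum_le hnonneg hsum).trans herr⟩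

theorem one_sub_le_iidProb_tvDist_plugIn_le (hr : G.IsTopologicalOrder r) (hS : G.IsCClosed S)
    (hXS : X ∈ S) (hchild : ∀ c ∈ S, ¬ G.directed X c) {α : ℝ} (hα : 0 < α)
    (hpos : ∀ τ, α ≤ cyl M.obs (G.paPlus S) τ) (F : Finset V) (x : A) (m : ℕ)
    (hη₀ : 0 ≤ η) (hη : η ≤ 1 / 2) (hηε : Real.exp (8 * S.card * η) * (1 + η) - 1 ≤ ε)
    (hε : ε < 1) :
    1 - (Fintype.card A : ℝ) ^ (F.card + (G.paPlus S).card) *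
        (2 * Real.exp (-(m * α * (η / Fintype.card A ^ F.card) ^ 2 / 4))) ≤
      iidProb M.obs m fun s =>
        (IsDistribution fun w => plugIn r S (G.paPlus S) F X x (empirical s) w /
          ∑ w', plugIn r S (G.paPlus S) F X x (empirical s) w') ∧
        tvDist (marginal F (M.interv X x)) (fun w =>
          plugIn r S (G.paPlus S) F X x (empirical s) w /
            ∑ w', plugIn r S (G.paPlus S) F X x (empirical s) w') ≤ ε := by
  have hobs := M.isDistribution_obs
  have hcard : ((Fintype.card ((F → A) × (G.paPlus S → A)) : ℕ) : ℝ) =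
      (Fintype.card A : ℝ) ^ (F.card + (G.paPlus S).card) := by
    simp [pow_add]
  have hη₂ : η / (Fintype.card A : ℝ) ^ F.card ≤ 2 :=
    (div_le_self hη₀ (one_le_pow₀ (by exact_mod_cast Fintype.card_pos))).trans (by linarith)
  have hconc := hobs.one_sub_le_iidProb_forall m (ι := (F → A) × (G.paPlus S → A))
    (E := fun i σ => (∀ v ∈ F, σ v = extend x i.1 v) ∧ ∀ v ∈ G.paPlus S, σ v = extend x i.2 v)
    (q := fun i => cyl M.obs (G.paPlus S) (extend x i.2))
    (fun _ => mass_mono hobs.1 fun _ h => h.2) (fun _ => hpos _) (by positivity) hη₂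
  rw [hcard] at hconc
  refine hconc.trans (mass_mono (hobs.pi m).1 fun s h => ?_)
  exact M.tvDist_plugIn_div_sum_le hr hS hXS hchild (fun τ => hα.trans_le (hpos τ)) F x
    (fun _ => by unfold empirical; positivity) hη₀ hη hηε hε fun w z => h (w, z)

end CausalBayesNet

/-! ### Parameters -/

namespace ADMG

variable {V : Type*} [Fintype V] (G : ADMG V)

theorem card_cComponent_le (X : V) : (G.cComponent X).card ≤ G.maxCComponent :=
  Finset.le_sup (f := fun v => (G.cComponent v).card) (Finset.mem_univ X)

theorem card_paPlus_le [DecidableEq V] (S : Finset V) :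
    (G.paPlus S).card ≤ S.card * (G.inDegree + 1) :=
  calc (G.paPlus S).card ≤ S.card + (S.biUnion G.parents).card := Finset.card_union_le _ _
    _ ≤ S.card + S.card * G.inDegree :=
        Nat.add_le_add_left (Finset.card_biUnion_le_card_mul _ _ _ fun v _ =>
          Finset.le_sup (f := fun v => (G.parents v).card) (Finset.mem_univ v)) _
    _ = S.card * (G.inDegree + 1) := by ring

end ADMG

section Bounds

theorem le_pow_pred {s N : ℕ} (hs : 2 ≤ s) (hN : 1 ≤ N) : N ≤ s ^ (N - 1) := by
  have h : N - 1 < 2 ^ (N - 1) := Nat.lt_two_pow_self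
  exact (by omega : N ≤ 2 ^ (N - 1)).trans (Nat.pow_le_pow_left hs _)

theorem mul_pow_succ_le {s N : ℕ} (hs : 2 ≤ s) (hN : 1 ≤ N) :
    N * s ^ (N + 1) ≤ s ^ (2 * N ^ 2) :=
  calc N * s ^ (N + 1) ≤ s ^ (N - 1) * s ^ (N + 1) :=
        Nat.mul_le_mul_right _ (le_pow_pred hs hN)
    _ = s ^ (2 * N) := by rw [← pow_add]; congr 1; omega
    _ ≤ s ^ (2 * N ^ 2) := Nat.pow_le_pow_right (by omega) (by nlinarith)

theorem sq_mul_pow_mul_le {s N f : ℕ} (hs : 2 ≤ s) (hf : f + 1 ≤ N) :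
    N ^ 2 * s ^ (2 * f) * (1 + N * s) ≤ 2 * s ^ (2 * N ^ 2) := by
  obtain ⟨n, rfl⟩ : ∃ n, N = n + 1 := ⟨N - 1, by omega⟩
  have hn : n + 1 ≤ s ^ n := le_pow_pred hs (by omega)
  have hexponent : 5 * n + 1 ≤ 2 * (n + 1) ^ 2 := by nlinarith [sq_nonneg (2 * n - 1 : ℤ)]
  calc (n + 1) ^ 2 * s ^ (2 * f) * (1 + (n + 1) * s)
      ≤ (s ^ n) ^ 2 * s ^ (2 * n) * (2 * (s ^ n * s)) := by
        gcongr
        · omega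
        · omega
        · nlinarith
    _ = 2 * s ^ (5 * n + 1) := by ring
    _ ≤ 2 * s ^ (2 * (n + 1) ^ 2) := by gcongr; omega

theorem pow_mul_two_mul_exp_neg_le {s t δ : ℝ} (hs : 0 ≤ s) (hδ : 0 < δ) {N : ℕ}
    (ht : 1 + N * s + Real.log (1 / δ) ≤ t) : s ^ N * (2 * Real.exp (-t)) ≤ δ := by
  have hpow : s ^ N ≤ Real.exp (N * s) := by
    rw [Real.exp_nat_mul]
    gcongr
    linarith [Real.add_one_le_exp s]
  have htwo : (2 : ℝ) ≤ Real.exp 1 := by linarith [Real.add_one_le_exp (1 : ℝ)]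
  calc s ^ N * (2 * Real.exp (-t))
      ≤ Real.exp (N * s) * (Real.exp 1 * Real.exp (-(1 + N * s + Real.log (1 / δ)))) := by gcongr
    _ = Real.exp (Real.log δ) := by
        rw [← Real.exp_add, ← Real.exp_add, one_div, Real.log_inv]
        ring_nf
    _ = δ := Real.exp_log hδ

theorem one_add_add_le_of_sample_size_le {s N f m : ℕ} {α ε l : ℝ} (hs : 2 ≤ s) (hf : f + 1 ≤ N)
    (hα : 0 < α) (hε : 0 < ε) (hl : 0 ≤ l)
    (hm : 2 ^ 11 * ((s : ℝ) ^ (2 * N ^ 2) / (α * ε ^ 2) * (1 + l)) ≤ m) :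
    1 + N * s + l ≤ m * α * (ε / (16 * N) / (s : ℝ) ^ f) ^ 2 / 4 := by
  have hs₀ : (0 : ℝ) < s := by positivity
  have hN₀ : (0 : ℝ) < N := Nat.cast_pos.2 (by omega)
  have hnum : (N : ℝ) ^ 2 * (s : ℝ) ^ (2 * f) * (1 + N * s) ≤ 2 * (s : ℝ) ^ (2 * N ^ 2) := by
    exact_mod_cast sq_mul_pow_mul_le hs hf
  calc 1 + N * s + l ≤ (1 + N * s) * (1 + l) := by
        nlinarith [mul_nonneg (mul_pos hN₀ hs₀).le hl]
    _ ≤ 2 * (s : ℝ) ^ (2 * N ^ 2) / ((N : ℝ) ^ 2 * (s : ℝ) ^ (2 * f)) * (1 + l) := by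
        gcongr
        rwa [le_div_iff₀ (by positivity), mul_comm]
    _ = 2 ^ 11 * ((s : ℝ) ^ (2 * N ^ 2) / (α * ε ^ 2) * (1 + l)) * α *
          (ε / (16 * N) / (s : ℝ) ^ f) ^ 2 / 4 := by
        field_simp
        ring
    _ ≤ m * α * (ε / (16 * N) / (s : ℝ) ^ f) ^ 2 / 4 := by gcongr

theorem exp_mul_one_add_sub_one_le {ε : ℝ} (hε₀ : 0 ≤ ε) (hε₁ : ε ≤ 1) {K N : ℕ} (hK : K ≤ N)
    (hN : 1 ≤ N) :
    Real.exp (8 * K * (ε / (16 * N))) * (1 + ε / (16 * N)) - 1 ≤ ε := by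
  have hN' : (1 : ℝ) ≤ N := by exact_mod_cast hN
  have hexponent : 8 * K * (ε / (16 * N)) ≤ ε / 2 := by
    calc 8 * K * (ε / (16 * N)) ≤ 8 * N * (ε / (16 * N)) := by gcongr
      _ = ε / 2 := by field_simp; ring
  have hη : ε / (16 * N) ≤ ε / 16 := by gcongr; linarith
  have hexp : Real.exp (ε / 2) ≤ 1 + ε / 2 + (ε / 2) ^ 2 := by
    linarith [(abs_le.1 (Real.abs_exp_sub_one_sub_id_le (x := ε / 2)
      (by rw [abs_of_nonneg (by positivity)]; linarith))).2]
  calc Real.exp (8 * K * (ε / (16 * N))) * (1 + ε / (16 * N)) - 1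
      ≤ (1 + ε / 2 + (ε / 2) ^ 2) * (1 + ε / 16) - 1 := by
        gcongr
        exact (Real.exp_le_exp.2 hexponent).trans hexp
    _ ≤ ε := by nlinarith [mul_nonneg hε₀ (sub_nonneg.2 hε₁), mul_nonneg (sq_nonneg ε) hε₀]

theorem one_le_pow_div_pow_mul_sq {s n k : ℕ} {α ε : ℝ} (hs : 1 ≤ s) (hα₀ : 0 < α) (hα₁ : α ≤ 1)
    (hε₀ : 0 < ε) (hε₁ : ε ≤ 1) : 1 ≤ (s : ℝ) ^ n / (α ^ k * ε ^ 2) := by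
  rw [one_le_div (by positivity)]
  exact (mul_le_one₀ (pow_le_one₀ hα₀.le hα₁) (by positivity) (pow_le_one₀ hε₀.le hε₁)).trans
    (one_le_pow₀ (by exact_mod_cast hs))

theorem exists_nat_between_two_mul {b : ℝ} (hb : 1 ≤ b) : ∃ m : ℕ, b ≤ m ∧ m ≤ 2 * b :=
  ⟨⌈b⌉₊, Nat.le_ceil b, by linarith [Nat.ceil_lt_add_one (zero_le_one.trans hb)]⟩

end Bounds

namespace RAM

variable {V : Type*} [DecidableEq V] {A : Type*} [Fintype A] {m N : ℕ} {S Z F : Finset V}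

theorem length_evaluator_le_of_two_le_card (hA : 2 ≤ Fintype.card A) (hm : 1 ≤ m)
    (hF : F.card + 1 ≤ N) (x : A) :
    (evaluator x F).length ≤ 2 ^ 12 * (m * N * Fintype.card A ^ (2 * N ^ 2)) :=
  calc (evaluator x F).length ≤ 22 * (Fintype.card A ^ F.card * (F.card + 1)) :=
        length_evaluator_le x F
    _ ≤ 2 ^ 12 * (Fintype.card A ^ (2 * N ^ 2) * (m * N)) := by
        gcongr
        · norm_num
        · omega
        · nlinarith
        · exact hF.trans (Nat.le_mul_of_pos_left N hm)
    _ = 2 ^ 12 * (m * N * Fintype.card A ^ (2 * N ^ 2)) := by ring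

theorem length_learner_le_of_two_le_card [DecidableEq A] (hA : 2 ≤ Fintype.card A) (hm : 1 ≤ m)
    (hFZ : F.card + Z.card ≤ N) (hS : 1 ≤ S.card) (hSN : S.card ≤ N) (r : V → ℕ) (X : V) (x : A) :
    (learner m r S Z F X x).length ≤ 2 ^ 12 * (m * N * Fintype.card A ^ (2 * N ^ 2)) :=
  calc (learner m r S Z F X x).length
      ≤ 99 * (Fintype.card A ^ (N + 1) * (S.card * (m * N))) :=
        length_learner_le hm (hS.trans hSN) hFZ hS r X x
    _ ≤ 2 ^ 12 * (Fintype.card A ^ (N + 1) * (N * (m * N))) := by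
        gcongr
        norm_num
    _ = 2 ^ 12 * (m * N * (N * Fintype.card A ^ (N + 1))) := by ring
    _ ≤ 2 ^ 12 * (m * N * Fintype.card A ^ (2 * N ^ 2)) := by
        gcongr
        exact mul_pow_succ_le hA (hS.trans hSN)

end RAM

/-! ### Learning an interventional distribution -/

namespace ADMG

variable {V : Type u} [Fintype V] [DecidableEq V] {A : Type v} [Fintype A] [DecidableEq A]
  (G : ADMG V)

/-- The program `learn`, run on `m` samples, halts within `T` steps, and for every `α`-strongly
positive causal Bayes net over `G` its final memory is, with probability at least `1 - δ`, one on
which `eval` evaluates, within `T` steps per query, a distribution at distance at most `ε` from the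
marginal on `F` of `P_x`. Both programs have length at most `T`. -/
def Learns (X : V) (F : Finset V) (x : A) (α ε δ : ℝ) (m : ℕ) (T : ℝ)
    (learn eval : List (Instr V)) : Prop :=
  (learn.length : ℝ) ≤ T ∧ (eval.length : ℝ) ≤ T ∧
    ∃ out : (Fin m → V → A) → (ℕ → ℚ),
      (∀ s : Fin m → V → A,
        RAM.HaltsWithin learn (RAM.sampleInput s) (fun _ => 0) T (out s)) ∧
      ∀ M : CausalBayesNet.{u, v, w} G A, M.StronglyPositive X α →
        1 - δ ≤ iidProb M.obs m fun s =>
          ∃ p : (F → A) → ℝ,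
            IsDistribution p ∧
            tvDist (marginal F (M.interv X x)) p ≤ ε ∧
            RAM.IsEvaluator eval (out s) T p

variable {X : V} {F : Finset V} {x : A} {α ε δ T : ℝ} {m N : ℕ}

theorem learns_nil_of_subsingleton [Subsingleton A] (hε : 0 ≤ ε) (hδ : 0 ≤ δ) (hT : 1 ≤ T) :
    Learns.{u, v, w} G X F x α ε δ m T [] [.const 0 1] := by
  have : Nonempty A := ⟨x⟩
  have hconst : ∀ p : (F → A) → ℝ, IsDistribution p → p = fun _ => 1 := fun p hp => by
    funext w
    rw [← hp.2, Fintype.sum_subsingleton _ w]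
  have hone : IsDistribution fun _ : F → A => (1 : ℝ) :=
    ⟨fun _ => zero_le_one, Fintype.sum_subsingleton _ fun _ => x⟩
  have heval : ([.const 0 1] : List (Instr V)).length ≤ T := by simpa using hT
  have hjump : RAM.JumpFree ([.const 0 1] : List (Instr V)) := by simp [RAM.JumpFree]
  refine ⟨by simpa using zero_le_one.trans hT, heval, fun _ _ => 0,
    fun s => ⟨0, 0, by simpa using zero_le_one.trans hT, rfl, le_rfl⟩, fun M _ => ?_⟩
  rw [iidProb_eq_mass, (M.isDistribution_obs.pi m).mass_eq_one]
  · linarith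
  · refine fun s => ⟨fun _ => 1, hone, ?_, fun w => ⟨_, hjump.haltsWithin _ _ heval, ?_⟩⟩
    · rw [hconst _ (isDistribution_marginal (M.isDistribution_interv X x) F)]
      simpa [tvDist] using hε
    · simp [RAM.run, RAM.exec]

theorem learns_learner {r : V → ℕ} (hr : G.IsTopologicalOrder r) (hX : G.Identifiable X)
    (hα : 0 < α) {η : ℝ} (hη₀ : 0 ≤ η) (hη : η ≤ 1 / 2)
    (hηε : Real.exp (8 * (G.cComponent X).card * η) * (1 + η) - 1 ≤ ε) (hε : ε < 1)
    (hδ : (Fintype.card A : ℝ) ^ (F.card + (G.paPlus (G.cComponent X)).card) *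
      (2 * Real.exp (-(m * α * (η / Fintype.card A ^ F.card) ^ 2 / 4))) ≤ δ)
    (hlearn : ((RAM.learner m r (G.cComponent X) (G.paPlus (G.cComponent X)) F X x).length : ℝ) ≤ T)
    (heval : ((RAM.evaluator x F).length : ℝ) ≤ T) :
    Learns.{u, v, w} G X F x α ε δ m T
      (RAM.learner m r (G.cComponent X) (G.paPlus (G.cComponent X)) F X x)
      (RAM.evaluator x F) := by
  have : Nonempty A := ⟨x⟩
  refine ⟨hlearn, heval, _,
    fun s => (RAM.jumpFree_learner m r _ _ F X x).haltsWithin _ _ hlearn, fun M hM => ?_⟩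
  have hpos : ∀ τ, α ≤ cyl M.obs (G.paPlus (G.cComponent X)) τ := fun τ => by
    have h := (hM fun v => τ v).le
    rwa [marginal_eq_cyl _ _ x, dependsOn_cyl _ _ fun v hv =>
      (forall_mem_eq_extend_iff x (fun v => τ v) τ).2 rfl v hv |>.symm] at h
  refine (sub_le_sub_left hδ 1).trans ((M.one_sub_le_iidProb_tvDist_plugIn_le hr
    (G.isCClosed_cComponent X) (G.mem_cComponent_self X) (fun c hc hXc => hX c hXc hc) hα hpos F x m
    hη₀ hη hηε hε).trans (mass_mono (M.isDistribution_obs.pi m).1 fun s h => ?_))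
  exact ⟨_, h.1, h.2, RAM.isEvaluator_evaluator x (RAM.run_learner r _ _ F X x s) heval⟩

theorem exists_learns_of_two_le_card (hX : G.Identifiable X) (hα : 0 < α) (hε₀ : 0 < ε)
    (hε₁ : ε < 1) (hδ₀ : 0 < δ) (hδ₁ : δ ≤ 1) (hA : 2 ≤ Fintype.card A)
    (hN : F.card + (G.paPlus (G.cComponent X)).card ≤ N)
    (hm : 2 ^ 11 * ((Fintype.card A : ℝ) ^ (2 * N ^ 2) / (α * ε ^ 2) * (1 + Real.log (1 / δ))) ≤ m)
    (hm₁ : 1 ≤ m) :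
    ∃ learn eval, Learns.{u, v, w} G X F x α ε δ m
      (2 ^ 12 * (m * N * (Fintype.card A : ℝ) ^ (2 * N ^ 2))) learn eval := by
  have hS : 1 ≤ (G.cComponent X).card := Finset.card_pos.2 ⟨X, G.mem_cComponent_self X⟩
  have hSZ := Finset.card_le_card (subset_paPlus (G := G) (G.cComponent X))
  have hSN : (G.cComponent X).card ≤ N := by omega
  have hN₁ : 1 ≤ N := by omega
  have hN' : (1 : ℝ) ≤ N := by exact_mod_cast hN₁
  have hη : ε / (16 * N) ≤ 1 / 2 := by
    rw [div_le_div_iff₀ (by positivity) (by norm_num)]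
    linarith
  obtain ⟨r, hr⟩ := G.exists_isTopologicalOrder
  have hlearn := RAM.length_learner_le_of_two_le_card hA hm₁ hN hS hSN r X x
  have heval := RAM.length_evaluator_le_of_two_le_card (F := F) hA hm₁ (N := N) (by omega) x
  have hfail : (Fintype.card A : ℝ) ^ N *
      (2 * Real.exp (-(m * α * (ε / (16 * N) / Fintype.card A ^ F.card) ^ 2 / 4))) ≤ δ :=
    pow_mul_two_mul_exp_neg_le (by positivity) hδ₀ (one_add_add_le_of_sample_size_le hA (by omega)
      hα hε₀ (Real.log_nonneg ((one_le_div hδ₀).2 hδ₁)) hm)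
  have hcard : (Fintype.card A : ℝ) ^ (F.card + (G.paPlus (G.cComponent X)).card) ≤
      (Fintype.card A : ℝ) ^ N := pow_le_pow_right₀ (by exact_mod_cast (by omega)) hN
  exact ⟨_, _, G.learns_learner hr hX hα (by positivity) hη
    (exp_mul_one_add_sub_one_le hε₀.le hε₁.le hSN hN₁) hε₁
    ((mul_le_mul_of_nonneg_right hcard (by positivity)).trans hfail)
    (by exact_mod_cast hlearn) (by exact_mod_cast heval)⟩

theorem exists_learns (hX : G.Identifiable X) (hα : 0 < α) (hε₀ : 0 < ε) (hε₁ : ε < 1)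
    (hδ₀ : 0 < δ) (hδ₁ : δ ≤ 1) (hN : F.card + (G.paPlus (G.cComponent X)).card ≤ N)
    (hm : 2 ^ 11 * ((Fintype.card A : ℝ) ^ (2 * N ^ 2) / (α * ε ^ 2) * (1 + Real.log (1 / δ))) ≤ m)
    (hm₁ : 1 ≤ m) :
    ∃ learn eval, Learns.{u, v, w} G X F x α ε δ m
      (2 ^ 12 * (m * N * (Fintype.card A : ℝ) ^ (2 * N ^ 2))) learn eval := by
  rcases Nat.eq_or_lt_of_le (Fintype.card_pos_iff.2 ⟨x⟩) with hA | hA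
  · have : Subsingleton A := Fintype.card_le_one_iff_subsingleton.1 hA.ge
    have hN₁ : 1 ≤ N := (Finset.card_pos.2
      ⟨X, subset_paPlus (G := G) _ (G.mem_cComponent_self X)⟩).trans_le (by omega)
    have hmN : (1 : ℝ) ≤ m * N := by exact_mod_cast Nat.mul_pos hm₁ hN₁
    refine ⟨_, _, G.learns_nil_of_subsingleton hε₀.le hδ₀.le ?_⟩
    rw [← hA, Nat.cast_one, one_pow]
    linarith
  · exact G.exists_learns_of_two_le_card hX hα hε₀ hε₁ hδ₀ hδ₁ hA hN hm hm₁

end ADMG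

theorem mainTheorem3 :
    ∃ (C : ℝ) (c : ℕ), 0 < C ∧
      ∀ (V : Type u) [Fintype V] [DecidableEq V] (A : Type v) [Fintype A] [DecidableEq A]
        (G : ADMG V) (X : V) (_ : G.Identifiable X) (F : Finset V) (x : A)
        (α ε δ : ℝ) (_ : 0 < α) (_ : α < 1) (_ : 0 < ε) (_ : ε < 1) (_ : 0 < δ) (_ : δ < 1)
        (k d N : ℕ) (_ : k = G.maxCComponent) (_ : d = G.inDegree)
        (_ : N = F.card + k * (d + 1))
        (B : ℝ) (_ : B = (Fintype.card A : ℝ) ^ (2 * N ^ 2) / (α ^ k * ε ^ 2)),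
        ∃ (m : ℕ) (T : ℝ) (learn eval : List (Instr V)),
          (m : ℝ) ≤ C * (B * (1 + Real.log B) ^ c * (1 + Real.log (1 / δ))) ∧
          T = C * (m * N * (Fintype.card A : ℝ) ^ (2 * N ^ 2)) ∧
          (learn.length : ℝ) ≤ T ∧ (eval.length : ℝ) ≤ T ∧
          ∃ out : (Fin m → V → A) → (ℕ → ℚ),
            (∀ s : Fin m → V → A,
              RAM.HaltsWithin learn (RAM.sampleInput s) (fun _ => 0) T (out s)) ∧
            ∀ M : CausalBayesNet.{u, v, w} G A, M.StronglyPositive X α →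
              1 - δ ≤ iidProb M.obs m fun s =>
                ∃ p : (F → A) → ℝ,
                  IsDistribution p ∧
                  tvDist (marginal F (M.interv X x)) p ≤ ε ∧
                  RAM.IsEvaluator eval (out s) T p := by
  refine ⟨2 ^ 12, 0, by norm_num, ?_⟩
  rintro V _ _ A _ _ G X hX F x α ε δ hα hα₁ hε hε₁ hδ hδ₁ k d N hk hd hN B hB
  have hS₁ : 1 ≤ (G.cComponent X).card := Finset.card_pos.2 ⟨X, G.mem_cComponent_self X⟩
  have hSk : (G.cComponent X).card ≤ k := hk ▸ G.card_cComponent_le X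
  have hZ : (G.paPlus (G.cComponent X)).card ≤ k * (d + 1) :=
    hd ▸ (G.card_paPlus_le _).trans (Nat.mul_le_mul_right _ hSk)
  have hαk : α ^ k ≤ α := pow_le_of_le_one hα.le hα₁.le (by omega)
  have hB₁ : 1 ≤ B :=
    hB ▸ one_le_pow_div_pow_mul_sq (Fintype.card_pos_iff.2 ⟨x⟩) hα hα₁.le hε hε₁.le
  have hl : 0 ≤ Real.log (1 / δ) := Real.log_nonneg ((one_le_div hδ).2 hδ₁.le)
  have hBl : 1 ≤ B * (1 + Real.log (1 / δ)) := one_le_mul_of_one_le_of_one_le hB₁ (by linarith)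
  obtain ⟨m, hm, hm'⟩ := exists_nat_between_two_mul (b := 2 ^ 11 * (B * (1 + Real.log (1 / δ))))
    (by linarith)
  have hm_αε : 2 ^ 11 * ((Fintype.card A : ℝ) ^ (2 * N ^ 2) / (α * ε ^ 2) *
      (1 + Real.log (1 / δ))) ≤ m := le_trans (by rw [hB]; gcongr) hm
  obtain ⟨learn, eval, hlearns⟩ := G.exists_learns (F := F) (x := x) (N := N) hX hα hε hε₁ hδ hδ₁.le
    (by omega) hm_αε (Nat.one_le_cast.1 (by linarith : (1 : ℝ) ≤ m))
  exact ⟨m, _, learn, eval, by rw [pow_zero, mul_one]; linarith, rfl, hlearns⟩
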